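/- Let $\Omega\subset\mathbb R^2$ be a bounded Lipschitz domain (open, connected) with arc-length measure $\sigma$ on $\partial\Omega$, and let $\Gamma_D,\Gamma_N,\Gamma_R$ be pairwise disjoint relatively open subsets of $\partial\Omega$, each of positive $\sigma$-measure, with $\partial\Omega=\overline{\Gamma_D}\cup\overline{\Gamma_N}\cup\overline{\Gamma_R}$. Let $V=\{v\in H^1(\Omega): v=0 \text{ on } \Gamma_D\}$ (in the sense of traces), with the norm $\|v\|_V=\|\nabla v\|_{L^2(\Omega)}$. For a part $\Gamma$ of $\partial\Omega$ and $p\ge 1$ put $$c_p(\Gamma)=\inf\{C>0:\ \|v_{|\Gamma}\|_{L^p(\Gamma)}\le C\|v\|_V\ \text{ for all } v\in V\},$$ and let $\beta_1=c_2(\Gamma_R)$, $\beta_2=c_3(\Gamma_R)$ and $\beta_N=c_2(\Gamma_N)$. Let $\alpha\in(0,1)$, $\phi\in L^2(\Gamma_N)$, $g\in L^2(\Gamma_R)$, and $$M_0=2\max(\beta_1,\beta_N)\big(\|\phi\|_{L^2(\Gamma_N)}+\|g\|_{L^2(\Gamma_R)}\big).$$ Let $\varepsilon$ be a real number with $0<\varepsilon<\min\Big(\dfrac1{4\beta_1^2},\dfrac1{2\beta_2^3M_0}\Big)$,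 where $1/0$ is read as $+\infty$, and let $\varphi\in C(\overline{\Gamma_R})$ with $\|\varphi\|_{L^\infty(\Gamma_R)}<\varepsilon$. Consider the problem $$(RP)\quad \Delta u=0 \text{ in }\Omega,\qquad u=0\text{ on }\Gamma_D,\qquad \frac{\partial u}{\partial n}=\phi\text{ on }\Gamma_N,\qquad \frac{\partial u}{\partial n}+\varphi\Big(u+\frac{2\alpha-1}{2}u^2\Big)=g\text{ on }\Gamma_R,$$ whose weak solutions are the $u\in V$ such that, for all $v\in V$, $$\int_\Omega\nabla u\cdot\nabla v+\int_{\Gamma_R}\varphi\Big(u+\frac{2\alpha-1}{2}u^2\Big)v\,d\sigma=\int_{\Gamma_N}\phi v\,d\sigma+\int_{\Gamma_R}gv\,d\sigma .$$ Then: 1. $(RP)$ has a weak solution $u\in V$ with $\|u\|_V\le M_0$. 2. This solution is the only weak solution of $(RP)$ in $\{h\in V:\|h\|_V\le M_0\}$. -/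

import Mathlib

open MeasureTheory Filter Topology
open scoped ENNReal NNReal ContDiff

noncomputable section

namespace RobinProblem

/-- The Euclidean plane. -/
abbrev Plane : Type := EuclideanSpace ℝ (Fin 2)

/-- A bounded Lipschitz domain of the plane: a bounded, connected, open set which near each of its
boundary points is, in suitable orthonormal coordinates, the strict epigraph of a Lipschitz
function. -/
structure IsLipschitzDomain (Ω : Set Plane) : Prop where
  isOpen : IsOpen Ω
  isBounded : Bornology.IsBounded Ω
  isConnected : IsConnected Ω
  chart : ∀ x ∈ frontier Ω, ∃ (e : Plane ≃ₗᵢ[ℝ] Plane) (γ : ℝ → ℝ) (K : ℝ≥0) (r : ℝ),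
    LipschitzWith K γ ∧ 0 < r ∧ ∀ y ∈ Metric.ball x r, y ∈ Ω ↔ γ (e y 0) < e y 1

/-- The superficial (arc length) measure on the boundary of `Ω`. -/
def surf (Ω : Set Plane) : Measure Plane := (Measure.hausdorffMeasure 1).restrict (frontier Ω)

/-- The boundary is decomposed into a Dirichlet, a Neumann and a Robin part: relatively open,
pairwise disjoint, of positive superficial measure, and with closures that cover the boundary. -/
structure IsBoundaryPartition (Ω ΓD ΓN ΓR : Set Plane) : Prop where
  openD : ∃ U, IsOpen U ∧ ΓD = U ∩ frontier Ω
  openN : ∃ U, IsOpen U ∧ ΓN = U ∩ frontier Ω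
  openR : ∃ U, IsOpen U ∧ ΓR = U ∩ frontier Ω
  cover : frontier Ω = closure ΓD ∪ closure ΓN ∪ closure ΓR
  disjDN : Disjoint ΓD ΓN
  disjDR : Disjoint ΓD ΓR
  disjNR : Disjoint ΓN ΓR
  posD : 0 < surf Ω ΓD
  posN : 0 < surf Ω ΓN
  posR : 0 < surf Ω ΓR

/-- `G` is the weak (distributional) gradient of `u` on `Ω`. -/
def IsWeakGradient (Ω : Set Plane) (u : Plane → ℝ) (G : Plane → Plane) : Prop :=
  ∀ η : Plane → ℝ, ContDiff ℝ ∞ η → HasCompactSupport η → tsupport η ⊆ Ω →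
    ∀ e : Plane, ∫ x in Ω, u x * fderiv ℝ η x e = -∫ x in Ω, inner ℝ (G x) e * η x

/-- The Sobolev space `H¹(Ω)`. An element is a class `val ∈ L²(Ω)` together with its weak
gradient `grad ∈ L²(Ω)`, which is determined by `val`. -/
structure H1 (Ω : Set Plane) where
  val : Lp ℝ 2 (volume.restrict Ω)
  grad : Lp Plane 2 (volume.restrict Ω)
  isWeakGradient : IsWeakGradient Ω val grad

/-- `t ∈ L²(∂Ω)` is the trace of `u ∈ H¹(Ω)`: the trace map is the continuous extension to `H¹(Ω)`
of the restriction to `∂Ω` of functions that are smooth up to the boundary. -/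
def IsTrace {Ω : Set Plane} (u : H1 Ω) (t : Lp ℝ 2 (surf Ω)) : Prop :=
  ∃ w : ℕ → Plane → ℝ, (∀ n, ContDiff ℝ ∞ (w n) ∧ HasCompactSupport (w n)) ∧
    Tendsto (fun n => eLpNorm (fun x => w n x - u.val x) 2 (volume.restrict Ω)) atTop (𝓝 0) ∧
    Tendsto (fun n => eLpNorm (fun x => gradient (w n) x - u.grad x) 2 (volume.restrict Ω))
      atTop (𝓝 0) ∧
    Tendsto (fun n => eLpNorm (fun x => w n x - t x) 2 (surf Ω)) atTop (𝓝 0)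

/-- The space `V = {v ∈ H¹(Ω) : v = 0 on ΓD}`. An element carries its trace on `∂Ω`, which on a
Lipschitz domain exists and is determined by the `H¹` function. -/
structure V (Ω ΓD : Set Plane) extends H1 Ω where
  trace : Lp ℝ 2 (surf Ω)
  isTrace : IsTrace toH1 trace
  trace_eq_zero : ∀ᵐ x ∂(surf Ω).restrict ΓD, trace x = 0

/-- The norm `‖u‖_V = ‖∇u‖_{L²(Ω)}`. -/
def normV {Ω ΓD : Set Plane} (u : V Ω ΓD) : ℝ≥0∞ := eLpNorm u.grad 2 (volume.restrict Ω)

/-- The best constant `inf {C > 0 : ‖u‖_{L^p(Γ)} ≤ C ‖u‖_V for all u ∈ V}` for the trace on a part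
`Γ` of the boundary (the infimum is taken in `[0, ∞]`). -/
def traceConst (Ω ΓD Γ : Set Plane) (p : ℝ≥0∞) : ℝ≥0∞ :=
  ⨅ (C : ℝ≥0) (_ : 0 < C ∧
    ∀ u : V Ω ΓD, eLpNorm u.trace p ((surf Ω).restrict Γ) ≤ C * normV u), (C : ℝ≥0∞)

/-- The radius `M₀`; `Φ` is the Neumann datum on `ΓN` and `g` the Robin datum on `ΓR`. -/
def M₀ (Ω ΓD ΓN ΓR : Set Plane) (Φ g : Plane → ℝ) : ℝ≥0∞ :=
  2 * max (traceConst Ω ΓD ΓR 2) (traceConst Ω ΓD ΓN 2) *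
    (eLpNorm Φ 2 ((surf Ω).restrict ΓN) + eLpNorm g 2 ((surf Ω).restrict ΓR))

/-- `u ∈ V` is a weak solution of `Δu = 0` in `Ω`, `u = 0` on `ΓD`, `∂u/∂n = Φ` on `ΓN`,
`∂u/∂n + φ (u + (2α - 1)/2 u²) = g` on `ΓR`. -/
def IsWeakSolution {Ω ΓD : Set Plane} (ΓN ΓR : Set Plane) (α : ℝ) (φ Φ g : Plane → ℝ)
    (u : V Ω ΓD) : Prop :=
  ∀ v : V Ω ΓD,
    (∫ x in Ω, inner ℝ (u.grad x) (v.grad x)) +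
      (∫ x in ΓR, φ x * (u.trace x + (2 * α - 1) / 2 * u.trace x ^ 2) * v.trace x ∂(surf Ω)) =
    (∫ x in ΓN, Φ x * v.trace x ∂(surf Ω)) + ∫ x in ΓR, g x * v.trace x ∂(surf Ω)

end RobinProblem

end

open RobinProblem

noncomputable section

namespace RobinProblem

/-! Let J be the Riesz isomorphism of V, ℓ the load and N u the functional v ↦ ∫_{Γ_R} φ(u + κu²)v,
where κ = (2α-1)/2 and |κ| ≤ 1/2. Weak solutions are the fixed points of u ↦ J⁻¹(ℓ - N u). Since u²
- w² = (u+w)(u-w), Hölder's inequality with exponents (2,2) and (3,3,3) bounds the Lipschitz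
constant on the ball of radius M₀ by εβ₁² + ½·εβ₂³·2M₀ ≤ 1/4 + 1/2. The ball is invariant because
‖ℓ‖ ≤ M₀/2 and ‖N u‖ ≤ M₀/4 + M₀/4. Banach's fixed point theorem then gives existence and uniqueness
together (`existsUnique_of_lipschitz`, `existsUnique_robin`).

This requires V to be complete for the gradient norm, with a continuous trace into L²(∂Ω). Both
follow from a Friedrichs inequality for smooth functions, which passes to limits
(`exists_friedrichs`, `exists_norm_le_norm_grad`). It is proved without compactness. Translating a
set inside Ω changes the L² norm of w by at most the energy, so chains of translations carry a
Poincaré inequality from one ball to all of Ω (`IsLipschitzDomain.controls`). Averaging over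
vertical segments above the boundary graph gives the trace inequality, and the trace on Γ_D fixes
the remaining additive constant.

No embedding of traces into L³ is needed. If M₀ > 0, the bound on ε forces β₂ < ∞; if M₀ = 0, the
ball is {0} and the load vanishes on V. -/

/-! ### Energy estimates for increments and translations -/

theorem ennreal_add_sq_le (a b : ℝ≥0∞) : (a + b) ^ 2 ≤ 2 * a ^ 2 + 2 * b ^ 2 := by
  have h := ENNReal.rpow_add_le_mul_rpow_add_rpow a b (p := 2) (by norm_num)
  have h1 : (2 : ℝ) - 1 = 1 := by norm_num
  rw [h1, ENNReal.rpow_one] at h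
  simpa [mul_add] using h

/-- The Cauchy–Schwarz inequality against the constant function `1`. -/
theorem lintegral_sq_le {X : Type*} [MeasurableSpace X] {μ : Measure X} {f : X → ℝ≥0∞}
    (hf : AEMeasurable f μ) : (∫⁻ x, f x ∂μ) ^ 2 ≤ μ Set.univ * ∫⁻ x, f x ^ 2 ∂μ := by
  have h := ENNReal.lintegral_mul_le_Lp_mul_Lq μ (p := 2) (q := 2)
    (Real.HolderConjugate.two_two) (f := fun _ => 1) (g := f) aemeasurable_const hf
  have h2 := pow_le_pow_left₀ zero_le h 2
  have key : ∀ a : ℝ≥0∞, (a ^ (1 / 2 : ℝ)) ^ 2 = a := fun a => by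
    rw [← ENNReal.rpow_natCast, ← ENNReal.rpow_mul]; norm_num
  rw [mul_pow, key, key] at h2
  simpa using h2

theorem enorm_sub_sq_le {f f' : ℝ → ℝ} (hf : ∀ t, HasDerivAt f (f' t) t) (hc : Continuous f')
    {a b : ℝ} (hab : a ≤ b) :
    ‖f b - f a‖ₑ ^ 2 ≤ ENNReal.ofReal (b - a) * ∫⁻ t in Set.Ioc a b, ‖f' t‖ₑ ^ 2 := by
  rw [← intervalIntegral.integral_eq_sub_of_hasDerivAt (fun t _ => hf t)
    (hc.intervalIntegrable a b), intervalIntegral.integral_of_le hab]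
  calc _ ≤ (∫⁻ t in Set.Ioc a b, ‖f' t‖ₑ) ^ 2 := by
        gcongr; exact enorm_integral_le_lintegral_enorm _
    _ ≤ _ := by
        refine (lintegral_sq_le hc.enorm.measurable.aemeasurable).trans_eq ?_
        simp

theorem hasDerivAt_comp_line {w : Plane → ℝ} (hw : ContDiff ℝ 1 w) (x h : Plane) (t : ℝ) :
    HasDerivAt (fun t : ℝ => w (x + t • h)) (fderiv ℝ w (x + t • h) h) t := by
  have h1 : HasDerivAt (fun t : ℝ => x + t • h) h t := by
    simpa using ((hasDerivAt_id t).smul_const h).const_add x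
  exact (hw.differentiable one_ne_zero _).hasFDerivAt.comp_hasDerivAt t h1

theorem continuous_fderiv_comp {w : Plane → ℝ} (hw : ContDiff ℝ 1 w) :
    Continuous (fderiv ℝ w) := hw.continuous_fderiv one_ne_zero

/-- The increment of `w` along a segment, estimated by the energy on the segment. -/
theorem enorm_increment_sq_le {w : Plane → ℝ} (hw : ContDiff ℝ 1 w) (x h : Plane) {τ : ℝ}
    (hτ : 0 ≤ τ) :
    ‖w (x + τ • h) - w x‖ₑ ^ 2 ≤
      ENNReal.ofReal τ * (‖h‖ₑ ^ 2 * ∫⁻ t in Set.Ioc 0 τ, ‖fderiv ℝ w (x + t • h)‖ₑ ^ 2) := by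
  have hc : Continuous fun t : ℝ => fderiv ℝ w (x + t • h) :=
    (continuous_fderiv_comp hw).comp (by fun_prop)
  have := enorm_sub_sq_le (hasDerivAt_comp_line hw x h) (hc.clm_apply continuous_const) hτ
  simp only [zero_smul, add_zero, sub_zero] at this
  refine this.trans ?_
  gcongr
  rw [← lintegral_const_mul _ (hc.enorm.measurable.pow_const 2)]
  refine lintegral_mono fun t => ?_
  rw [← mul_pow]
  gcongr
  rw [mul_comm]
  exact ContinuousLinearMap.le_opENorm _ _

theorem setLIntegral_comp_add_le {A Ω : Set Plane} (hA : MeasurableSet A) (hΩ : MeasurableSet Ω)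
    (h : Plane) (hAΩ : ∀ x ∈ A, x + h ∈ Ω) (f : Plane → ℝ≥0∞) :
    ∫⁻ x in A, f (x + h) ≤ ∫⁻ x in Ω, f x := by
  calc ∫⁻ x in A, f (x + h) ≤ ∫⁻ x in A, Ω.indicator f (x + h) :=
        setLIntegral_mono' hA fun x hx => by rw [Set.indicator_of_mem (hAΩ x hx)]
    _ ≤ ∫⁻ x, Ω.indicator f (x + h) := setLIntegral_le_lintegral _ _
    _ = ∫⁻ x in Ω, f x := by
        rw [lintegral_add_right_eq_self (Ω.indicator f) h, lintegral_indicator hΩ]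

/-- The `L²` modulus of continuity is controlled by the energy. -/
theorem setLIntegral_translate_sub_sq_le {A Ω : Set Plane} (hA : MeasurableSet A)
    (hΩ : MeasurableSet Ω) (h : Plane)
    (hAΩ : ∀ x ∈ A, ∀ t ∈ Set.Ioc (0 : ℝ) 1, x + t • h ∈ Ω) {w : Plane → ℝ}
    (hw : ContDiff ℝ 1 w) :
    ∫⁻ x in A, ‖w (x + h) - w x‖ₑ ^ 2 ≤ ‖h‖ₑ ^ 2 * ∫⁻ x in Ω, ‖fderiv ℝ w x‖ₑ ^ 2 := by
  have hm : Measurable fun p : Plane × ℝ => ‖fderiv ℝ w (p.1 + p.2 • h)‖ₑ ^ 2 :=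
    ((continuous_fderiv_comp hw).comp (by fun_prop)).enorm.measurable.pow_const 2
  calc ∫⁻ x in A, ‖w (x + h) - w x‖ₑ ^ 2
      ≤ ∫⁻ x in A, ‖h‖ₑ ^ 2 * ∫⁻ t in Set.Ioc (0 : ℝ) 1, ‖fderiv ℝ w (x + t • h)‖ₑ ^ 2 :=
        lintegral_mono fun x => by simpa using enorm_increment_sq_le hw x h zero_le_one
    _ = ‖h‖ₑ ^ 2 * ∫⁻ t in Set.Ioc (0 : ℝ) 1, ∫⁻ x in A, ‖fderiv ℝ w (x + t • h)‖ₑ ^ 2 := by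
        rw [lintegral_const_mul _ hm.lintegral_prod_right',
          lintegral_lintegral_swap hm.aemeasurable]
    _ ≤ ‖h‖ₑ ^ 2 * ∫⁻ _ in Set.Ioc (0 : ℝ) 1, ∫⁻ x in Ω, ‖fderiv ℝ w x‖ₑ ^ 2 := by
        refine mul_le_mul_right ?_ _
        exact setLIntegral_mono' measurableSet_Ioc fun t ht =>
          setLIntegral_comp_add_le hA hΩ (t • h) (fun x hx => hAΩ x hx t ht)
            fun x => ‖fderiv ℝ w x‖ₑ ^ 2
    _ = _ := by simp

/-! ### Propagation of L² bounds by translation -/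

/-- The `L²` norm on `A` is controlled by the `L²` norm on `B` and the energy on `Ω`. -/
def Controls (Ω B A : Set Plane) : Prop :=
  ∃ C : ℝ≥0, ∀ w : Plane → ℝ, ContDiff ℝ 1 w →
    ∫⁻ x in A, ‖w x‖ₑ ^ 2 ≤ C * ((∫⁻ x in B, ‖w x‖ₑ ^ 2) + ∫⁻ x in Ω, ‖fderiv ℝ w x‖ₑ ^ 2)

namespace Controls

variable {Ω A A' B D : Set Plane}

theorem mono (h : Controls Ω B A) (hA : A' ⊆ A) : Controls Ω B A' := by
  obtain ⟨C, hC⟩ := h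
  exact ⟨C, fun w hw => (lintegral_mono_set hA).trans (hC w hw)⟩

theorem of_subset (h : A ⊆ B) : Controls Ω B A :=
  ⟨1, fun w _ => by simpa using (lintegral_mono_set h).trans le_self_add⟩

theorem union (h : Controls Ω B A) (h' : Controls Ω B A') : Controls Ω B (A ∪ A') := by
  obtain ⟨C, hC⟩ := h
  obtain ⟨C', hC'⟩ := h'
  refine ⟨C + C', fun w hw => (lintegral_union_le _ _ _).trans ?_⟩
  rw [ENNReal.coe_add, add_mul]
  exact add_le_add (hC w hw) (hC' w hw)

theorem trans (h : Controls Ω B A) (h' : Controls Ω A D) : Controls Ω B D := by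
  obtain ⟨C, hC⟩ := h
  obtain ⟨C', hC'⟩ := h'
  refine ⟨C' * (C + 1), fun w hw => (hC' w hw).trans ?_⟩
  rw [ENNReal.coe_mul, mul_assoc]
  gcongr
  calc _ ≤ C * ((∫⁻ x in B, ‖w x‖ₑ ^ 2) + ∫⁻ x in Ω, ‖fderiv ℝ w x‖ₑ ^ 2) +
        ((∫⁻ x in B, ‖w x‖ₑ ^ 2) + ∫⁻ x in Ω, ‖fderiv ℝ w x‖ₑ ^ 2) :=
        add_le_add (hC w hw) le_add_self
    _ = _ := by push_cast; ring

/-- Write w(x) = w(x+h) - (w(x+h) - w(x)). The first term is integrated over a translate of A lying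
in B; the second is bounded by the energy because the segments from x to x+h run in Ω. -/
theorem translate (hΩ : MeasurableSet Ω) (hA : MeasurableSet A) (hB : MeasurableSet B) (h : Plane)
    (hAB : ∀ x ∈ A, x + h ∈ B) (hAΩ : ∀ x ∈ A, ∀ t ∈ Set.Ioc (0 : ℝ) 1, x + t • h ∈ Ω) :
    Controls Ω B A := by
  refine ⟨2 + 2 * ‖h‖₊ ^ 2, fun w hw => ?_⟩
  have hm : Measurable fun x => ‖w (x + h)‖ₑ ^ 2 :=
    (hw.continuous.comp (by fun_prop)).enorm.measurable.pow_const 2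
  calc ∫⁻ x in A, ‖w x‖ₑ ^ 2
      ≤ ∫⁻ x in A, (2 * ‖w (x + h)‖ₑ ^ 2 + 2 * ‖w (x + h) - w x‖ₑ ^ 2) := by
        refine lintegral_mono fun x => le_trans ?_ (ennreal_add_sq_le _ _)
        dsimp only
        gcongr
        calc ‖w x‖ₑ = ‖w (x + h) - (w (x + h) - w x)‖ₑ := by rw [sub_sub_cancel]
          _ ≤ _ := enorm_sub_le
    _ = 2 * (∫⁻ x in A, ‖w (x + h)‖ₑ ^ 2) + 2 * ∫⁻ x in A, ‖w (x + h) - w x‖ₑ ^ 2 := by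
        rw [lintegral_add_left (hm.const_mul 2), lintegral_const_mul _ hm, lintegral_const_mul]
        have := hw.continuous
        exact (by fun_prop : Continuous fun x => w (x + h) - w x).enorm.measurable.pow_const 2
    _ ≤ 2 * (∫⁻ x in B, ‖w x‖ₑ ^ 2) + 2 * (‖h‖ₑ ^ 2 * ∫⁻ x in Ω, ‖fderiv ℝ w x‖ₑ ^ 2) := by
        refine add_le_add (mul_le_mul_right ?_ _) (mul_le_mul_right ?_ _)
        · exact setLIntegral_comp_add_le hA hB h hAB fun x => ‖w x‖ₑ ^ 2
        · exact setLIntegral_translate_sub_sq_le hA hΩ h hAΩ hw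
    _ ≤ (2 + 2 * ‖h‖ₑ ^ 2) * (∫⁻ x in B, ‖w x‖ₑ ^ 2) +
        (2 + 2 * ‖h‖ₑ ^ 2) * ∫⁻ x in Ω, ‖fderiv ℝ w x‖ₑ ^ 2 := by
        rw [← mul_assoc]
        gcongr
        · exact le_self_add
        · exact le_add_self
    _ = _ := by
        rw [mul_add]; push_cast; rfl

theorem of_isCompact {K : Set Plane} (hK : IsCompact K)
    (h : ∀ x ∈ K, ∃ U ∈ 𝓝 x, Controls Ω B (U ∩ A)) : Controls Ω B (K ∩ A) := by
  refine hK.induction_on (p := fun s => Controls Ω B (s ∩ A)) ?_ ?_ ?_ ?_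
  · simpa using of_subset (Set.empty_subset B)
  · exact fun s t hst ht => ht.mono (Set.inter_subset_inter_left _ hst)
  · intro s t hs ht
    rw [Set.union_inter_distrib_right]
    exact hs.union ht
  · intro x hx
    obtain ⟨U, hU, h⟩ := h x hx
    exact ⟨U, mem_nhdsWithin_of_mem_nhds hU, h⟩

end Controls

/-- In a connected open set, any ball controls a neighbourhood of every point. -/
theorem controls_nhds {Ω : Set Plane} (hΩ : IsOpen Ω) (hc : IsPreconnected Ω) {x₀ : Plane} {r : ℝ}
    (hr : 0 < r) (hx₀ : x₀ ∈ Ω) {x : Plane} (hx : x ∈ Ω) :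
    ∃ U ∈ 𝓝 x, Controls Ω (Metric.ball x₀ r) U := by
  -- Connectedness: the set of controlled points is open, contains x₀ and is relatively closed in Ω.
  have key : Ω ⊆ {x | ∃ U ∈ 𝓝 x, Controls Ω (Metric.ball x₀ r) U} := by
    refine hc.subset_of_closure_inter_subset ?_ ⟨x₀, hx₀, _, Metric.ball_mem_nhds x₀ hr,
      Controls.of_subset subset_rfl⟩ ?_
    · rw [isOpen_iff_mem_nhds]
      rintro y ⟨U, hU, h⟩
      obtain ⟨U', hU', ho, hy⟩ := mem_nhds_iff.1 hU
      filter_upwards [ho.mem_nhds hy] with z hz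
      exact ⟨U, mem_nhds_iff.2 ⟨U', hU', ho, hz⟩, h⟩
    · rintro y ⟨hy, hyΩ⟩
      obtain ⟨ρ, hρ, hball⟩ := Metric.isOpen_iff.1 hΩ y hyΩ
      obtain ⟨z, ⟨U, hU, hUc⟩, hz⟩ := Metric.mem_closure_iff.1 hy (ρ / 2) (half_pos hρ)
      obtain ⟨s, hs, hsU⟩ := Metric.mem_nhds_iff.1 hU
      -- The radius t ≤ s puts the translate of the ball at y inside the controlled ball at z; t ≤
      -- ρ/2, together with |z - y| < ρ/2, keeps the connecting segments in the ball of radius ρ at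
      -- y.
      set t := min s (ρ / 2) with ht
      have ht0 : 0 < t := lt_min hs (half_pos hρ)
      refine ⟨Metric.ball y t, Metric.ball_mem_nhds y ht0,
        (hUc.mono hsU).trans (Controls.translate hΩ.measurableSet measurableSet_ball
          measurableSet_ball (z - y) ?_ ?_)⟩
      · intro p hp
        rw [Metric.mem_ball, dist_eq_norm] at hp ⊢
        rw [show p + (z - y) - z = p - y by abel]
        exact hp.trans_le (min_le_left _ _)
      · intro p hp τ hτ
        apply hball
        rw [Metric.mem_ball, dist_eq_norm] at hp ⊢
        rw [dist_comm, dist_eq_norm] at hz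
        calc ‖p + τ • (z - y) - y‖ = ‖(p - y) + τ • (z - y)‖ := by congr 1; abel
          _ ≤ ‖p - y‖ + τ * ‖z - y‖ := by
            refine (norm_add_le _ _).trans_eq ?_
            rw [norm_smul, Real.norm_of_nonneg hτ.1.le]
          _ < ρ / 2 + 1 * (ρ / 2) := by
            refine add_lt_add_of_lt_of_le (hp.trans_le (min_le_right _ _)) ?_
            exact mul_le_mul hτ.2 hz.le (norm_nonneg _) zero_le_one
          _ = ρ := by ring
  exact key hx

/-! ### Poincaré inequality on a ball -/

/-- The Poincaré inequality on a ball. -/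
theorem exists_setLIntegral_ball_sub_sq_le {Ω : Set Plane} (hΩ : MeasurableSet Ω) {x₀ : Plane}
    {r : ℝ} (hr : 0 < r) (hB : Metric.ball x₀ r ⊆ Ω) :
    ∃ C : ℝ≥0, ∀ w : Plane → ℝ, ContDiff ℝ 1 w → ∃ c : ℝ,
      ∫⁻ x in Metric.ball x₀ r, ‖w x - c‖ₑ ^ 2 ≤ C * ∫⁻ x in Ω, ‖fderiv ℝ w x‖ₑ ^ 2 := by
  set B := Metric.ball x₀ r with hBdef
  have hBm : MeasurableSet B := measurableSet_ball
  have hB0 : volume B ≠ 0 := (Metric.measure_ball_pos volume x₀ hr).ne'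
  have hB1 : volume B ≠ ⊤ := measure_ball_lt_top.ne
  have hD1 : volume (Metric.ball (0 : Plane) (2 * r)) ≠ ⊤ := measure_ball_lt_top.ne
  refine ⟨((volume B)⁻¹ * (ENNReal.ofReal (2 * r) ^ 2 *
    volume (Metric.ball (0 : Plane) (2 * r)))).toNNReal, fun w hw => ?_⟩
  rw [ENNReal.coe_toNNReal (ENNReal.mul_ne_top (ENNReal.inv_ne_top.2 hB0)
    (ENNReal.mul_ne_top (by finiteness) hD1))]
  set E := ∫⁻ x in Ω, ‖fderiv ℝ w x‖ₑ ^ 2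
  have hwc := hw.continuous
  have hm : Measurable fun p : Plane × Plane =>
      B.indicator (fun x => ‖w x - w p.1‖ₑ ^ 2) (p.1 + p.2) := by
    have : (fun p : Plane × Plane => B.indicator (fun x => ‖w x - w p.1‖ₑ ^ 2) (p.1 + p.2)) =
        ((fun p : Plane × Plane => p.1 + p.2) ⁻¹' B).indicator
          fun p => ‖w (p.1 + p.2) - w p.1‖ₑ ^ 2 := by
      rfl
    rw [this]
    refine Measurable.indicator ?_ (hBm.preimage (by fun_prop))
    exact (by fun_prop : Continuous fun p : Plane × Plane =>
      w (p.1 + p.2) - w p.1).enorm.measurable.pow_const 2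
  have hm2 : Measurable fun p : Plane × Plane => ‖w p.2 - w p.1‖ₑ ^ 2 :=
    (by fun_prop : Continuous fun p : Plane × Plane => w p.2 - w p.1).enorm.measurable.pow_const 2
  -- Substitute x = y + h: only |h| < 2r contributes, and for fixed h convexity of the ball makes
  -- the translation estimate applicable.
  have key : ∫⁻ y in B, ∫⁻ x in B, ‖w x - w y‖ₑ ^ 2 ≤
      ENNReal.ofReal (2 * r) ^ 2 * volume (Metric.ball (0 : Plane) (2 * r)) * E := by
    calc ∫⁻ y in B, ∫⁻ x in B, ‖w x - w y‖ₑ ^ 2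
        = ∫⁻ y in B, ∫⁻ h, B.indicator (fun x => ‖w x - w y‖ₑ ^ 2) (y + h) := by
          refine lintegral_congr fun y => ?_
          rw [lintegral_add_left_eq_self (B.indicator fun x => ‖w x - w y‖ₑ ^ 2) y,
            lintegral_indicator hBm]
      _ = ∫⁻ h, ∫⁻ y in B, B.indicator (fun x => ‖w x - w y‖ₑ ^ 2) (y + h) :=
          lintegral_lintegral_swap hm.aemeasurable
      _ ≤ ∫⁻ h, (Metric.ball (0 : Plane) (2 * r)).indicator
            (fun _ => ENNReal.ofReal (2 * r) ^ 2 * E) h := by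
          refine lintegral_mono fun h => ?_
          dsimp only
          have hAm : MeasurableSet ((fun y => y + h) ⁻¹' B) := hBm.preimage (by fun_prop)
          have h1 : ∫⁻ y in B, B.indicator (fun x => ‖w x - w y‖ₑ ^ 2) (y + h) =
              ∫⁻ y in (fun y => y + h) ⁻¹' B ∩ B, ‖w (y + h) - w y‖ₑ ^ 2 := by
            rw [← Measure.restrict_restrict hAm, ← lintegral_indicator hAm]
            refine lintegral_congr fun y => ?_
            rfl
          rw [h1]
          by_cases hh : h ∈ Metric.ball (0 : Plane) (2 * r)
          · rw [Set.indicator_of_mem hh]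
            refine (setLIntegral_translate_sub_sq_le (hAm.inter hBm) hΩ h ?_ hw).trans ?_
            · rintro y ⟨hy1, hy2⟩ t ht
              apply hB
              have := (convex_ball x₀ r).add_smul_mem hy2 hy1 ⟨ht.1.le, ht.2⟩
              exact this
            · gcongr
              rw [← ofReal_norm]
              exact ENNReal.ofReal_le_ofReal (mem_ball_zero_iff.1 hh).le
          · have : (fun y => y + h) ⁻¹' B ∩ B = ∅ := by
              rw [Set.eq_empty_iff_forall_notMem]
              rintro y ⟨hy1, hy2⟩
              apply hh
              rw [mem_ball_zero_iff]
              rw [Set.mem_preimage, hBdef, Metric.mem_ball, dist_eq_norm] at hy1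
              rw [hBdef, Metric.mem_ball, dist_eq_norm] at hy2
              calc ‖h‖ = ‖(y + h - x₀) - (y - x₀)‖ := by congr 1; abel
                _ ≤ ‖y + h - x₀‖ + ‖y - x₀‖ := norm_sub_le _ _
                _ < 2 * r := by linarith
            rw [this]; simp
      _ = _ := by
          rw [lintegral_indicator measurableSet_ball]; simp only [lintegral_const,
            MeasurableSet.univ, Measure.restrict_apply, Set.univ_inter]
          ring
  -- The constant c is a value w(y) at a point y where the inner integral does not exceed its mean
  -- over the ball; this replaces the mean value of w.
  obtain ⟨y, -, hy⟩ := exists_le_setLAverage hB0 hB1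
    (f := fun y => ∫⁻ x in B, ‖w x - w y‖ₑ ^ 2) hm2.lintegral_prod_right'.aemeasurable
  refine ⟨w y, hy.trans ?_⟩
  rw [setLAverage_eq, ENNReal.div_eq_inv_mul, mul_assoc]
  gcongr

/-! ### Control of the L² norm up to the boundary -/

section Chart

variable {Ω : Set Plane} {x : Plane} {e : Plane ≃ₗᵢ[ℝ] Plane} {γ : ℝ → ℝ} {K : ℝ≥0} {r : ℝ}

/-- The vertical direction of a system of orthonormal coordinates. -/
def up (e : Plane ≃ₗᵢ[ℝ] Plane) : Plane := e.symm !₂[0, 1]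

theorem norm_up (e : Plane ≃ₗᵢ[ℝ] Plane) : ‖up e‖ = 1 := by
  simp [up, EuclideanSpace.norm_eq]

theorem apply_add_up_zero (e : Plane ≃ₗᵢ[ℝ] Plane) (y : Plane) (t : ℝ) :
    e (y + t • up e) 0 = e y 0 := by
  simp [up]

theorem apply_add_up_one (e : Plane ≃ₗᵢ[ℝ] Plane) (y : Plane) (t : ℝ) :
    e (y + t • up e) 1 = e y 1 + t := by
  simp [up]

/-- The point of the graph of `γ` above the abscissa `s`. -/
def graphMap (e : Plane ≃ₗᵢ[ℝ] Plane) (γ : ℝ → ℝ) (s : ℝ) : Plane := e.symm !₂[s, γ s]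

/-- A frontier point of the open set Ω is not in Ω, hence not above the graph. It is not strictly
below either: that region is open and misses Ω inside the ball. -/
theorem eq_graphMap_of_mem_frontier (hΩ : IsOpen Ω) (hγ : Continuous γ)
    (h : ∀ y ∈ Metric.ball x r, y ∈ Ω ↔ γ (e y 0) < e y 1) {y : Plane}
    (hy : y ∈ Metric.ball x r) (hyf : y ∈ frontier Ω) : y = graphMap e γ (e y 0) := by
  have h1 : e y 1 ≤ γ (e y 0) := by
    rw [← not_lt, ← h y hy]
    rw [hΩ.frontier_eq] at hyf
    exact hyf.2
  have h2 : γ (e y 0) ≤ e y 1 := by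
    by_contra! hlt
    have hopen : IsOpen {z : Plane | e z 1 < γ (e z 0)} :=
      isOpen_lt (by fun_prop) (hγ.comp (by fun_prop))
    obtain ⟨z, hz, hzΩ⟩ := mem_closure_iff_nhds.1 (frontier_subset_closure hyf) _
      (inter_mem (hopen.mem_nhds hlt) (Metric.isOpen_ball.mem_nhds hy))
    exact lt_asymm hz.1 ((h z hz.2).1 hzΩ)
  rw [graphMap, LinearIsometryEquiv.eq_symm_apply]
  ext i
  fin_cases i
  · simp
  · simpa using le_antisymm h1 h2

/-- Vertical translation shows that near a boundary point the `L²` norm is controlled by the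
`L²` norm on a compact subset of `Ω`. -/
theorem exists_isCompact_controls (hΩ : IsOpen Ω) (hγ : Continuous γ) (hr : 0 < r)
    (h : ∀ y ∈ Metric.ball x r, y ∈ Ω ↔ γ (e y 0) < e y 1) :
    ∃ S ⊆ Ω, IsCompact S ∧ Controls Ω S (Metric.ball x (r / 4) ∩ Ω) := by
  have hclosed : IsClosed {y : Plane | γ (e y 0) + r / 2 ≤ e y 1} :=
    isClosed_le ((hγ.comp (by fun_prop)).add continuous_const) (by fun_prop)
  -- Target of the upward shift by r/2: it takes points within r/4 of x to distance at most 3r/4,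
  -- and points above the graph to height at least r/2 above it.
  have hS : IsCompact (Metric.closedBall x (3 / 4 * r) ∩ {y : Plane | γ (e y 0) + r / 2 ≤ e y 1}) :=
    (isCompact_closedBall x _).inter_right hclosed
  have hdist : ∀ y ∈ Metric.ball x (r / 4), ∀ t ∈ Set.Ioc (0 : ℝ) 1,
      dist (y + (t * (r / 2)) • up e) x ≤ 3 / 4 * r := by
    intro y hy t ht
    calc dist (y + (t * (r / 2)) • up e) x
        ≤ dist (y + (t * (r / 2)) • up e) y + dist y x := dist_triangle _ _ _
      _ ≤ 1 * (r / 2) + r / 4 := by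
        refine add_le_add ?_ (Metric.mem_ball.1 hy).le
        rw [dist_self_add_left, norm_smul, norm_up, mul_one,
          Real.norm_of_nonneg (mul_nonneg ht.1.le (half_pos hr).le)]
        exact mul_le_mul_of_nonneg_right ht.2 (half_pos hr).le
      _ = 3 / 4 * r := by ring
  have hlt : 3 / 4 * r < r := by linarith
  refine ⟨_, ?_, hS, Controls.translate hΩ.measurableSet
    (measurableSet_ball.inter hΩ.measurableSet) hS.measurableSet ((r / 2) • up e) ?_ ?_⟩
  · rintro y ⟨hy1, hy2⟩
    refine (h y (Metric.mem_ball.2 ((Metric.mem_closedBall.1 hy1).trans_lt hlt))).2 ?_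
    have : γ (e y 0) + r / 2 ≤ e y 1 := hy2
    linarith
  · rintro y ⟨hy1, hy2⟩
    refine ⟨by simpa using hdist y hy1 1 ⟨one_pos, le_rfl⟩, ?_⟩
    have := (h y (Metric.ball_subset_ball (by linarith) hy1)).1 hy2
    rw [Set.mem_ofPred_eq, apply_add_up_zero, apply_add_up_one]
    linarith
  · rintro y ⟨hy1, hy2⟩ t ht
    rw [smul_smul, h _ (Metric.mem_ball.2 ((hdist y hy1 t ht).trans_lt hlt)), apply_add_up_zero,
      apply_add_up_one]
    have := (h y (Metric.ball_subset_ball (by linarith) hy1)).1 hy2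
    have := mul_pos ht.1 (half_pos hr)
    linarith

end Chart

/-- The `L²` norm on a Lipschitz domain is controlled by the `L²` norm on any ball. -/
theorem IsLipschitzDomain.controls {Ω : Set Plane} (hΩ : IsLipschitzDomain Ω) {x₀ : Plane} {ρ : ℝ}
    (hρ : 0 < ρ) (hx₀ : x₀ ∈ Ω) : Controls Ω (Metric.ball x₀ ρ) Ω := by
  have hInt : ∀ x ∈ Ω, ∃ U ∈ 𝓝 x, Controls Ω (Metric.ball x₀ ρ) U := fun x hx =>
    controls_nhds hΩ.isOpen hΩ.isConnected.isPreconnected hρ hx₀ hx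
  refine (Controls.of_isCompact hΩ.isBounded.isCompact_closure fun x hx => ?_).mono
    (Set.subset_inter subset_closure subset_rfl)
  by_cases hxΩ : x ∈ Ω
  · obtain ⟨U, hU, h⟩ := hInt x hxΩ
    exact ⟨U, hU, h.mono Set.inter_subset_left⟩
  · obtain ⟨e, γ, K, r, hγ, hr, h⟩ := hΩ.chart x (by
      rw [hΩ.isOpen.frontier_eq]; exact ⟨hx, hxΩ⟩)
    obtain ⟨S, hSΩ, hS, hSc⟩ := exists_isCompact_controls hΩ.isOpen hγ.continuous hr h
    refine ⟨_, Metric.ball_mem_nhds x (by linarith), Controls.trans (A := S) ?_ hSc⟩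
    refine (Controls.of_isCompact (A := Set.univ) hS fun y hy => ?_).mono
      (Set.subset_inter subset_rfl (Set.subset_univ _))
    obtain ⟨U, hU, h⟩ := hInt y (hSΩ hy)
    exact ⟨U, hU, h.mono Set.inter_subset_left⟩

/-! ### Trace inequality on Lipschitz graphs -/

/-- A change of variables estimate for the one-dimensional Hausdorff measure on a Lipschitz
curve. -/
theorem setLIntegral_hausdorffMeasure_le {Ψ : ℝ → Plane} {L : ℝ≥0} (hΨ : LipschitzWith L Ψ)
    {I : Set ℝ} {S : Set Plane} (hS : S ⊆ Ψ '' I) {f : Plane → ℝ≥0∞} (hf : Measurable f) :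
    ∫⁻ y in S, f y ∂(Measure.hausdorffMeasure 1) ≤ L * ∫⁻ s in I, f (Ψ s) := by
  -- An L-Lipschitz map multiplies one-dimensional Hausdorff measure by at most L, so the estimate
  -- reduces to a comparison of measures.
  have hle : (Measure.hausdorffMeasure 1 : Measure Plane).restrict S ≤
      L • (volume.restrict I).map Ψ := by
    refine Measure.le_iff.2 fun A hA => ?_
    have hpre : MeasurableSet (Ψ ⁻¹' A) := hΨ.continuous.measurable hA
    rw [Measure.restrict_apply hA, Measure.smul_apply,
      Measure.map_apply hΨ.continuous.measurable hA, Measure.restrict_apply hpre]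
    have hsub : A ∩ S ⊆ Ψ '' (Ψ ⁻¹' A ∩ I) := by
      rintro y ⟨hyA, hyS⟩
      obtain ⟨s, hs, rfl⟩ := hS hyS
      exact ⟨s, ⟨hyA, hs⟩, rfl⟩
    refine (measure_mono hsub).trans ((hΨ.hausdorffMeasure_image_le zero_le_one _).trans_eq ?_)
    rw [hausdorffMeasure_real, ENNReal.rpow_one]
    rfl
  refine (lintegral_mono' hle le_rfl).trans_eq ?_
  rw [lintegral_smul_measure, lintegral_map hf hΨ.continuous.measurable]
  rfl

section Chart

variable {Ω : Set Plane} {x : Plane} {e : Plane ≃ₗᵢ[ℝ] Plane} {γ : ℝ → ℝ} {K : ℝ≥0} {r : ℝ}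

theorem norm_toLp_pair_le (a b : ℝ) : ‖(!₂[a, b] : Plane)‖ ≤ |a| + |b| := by
  rw [EuclideanSpace.norm_eq]
  refine Real.sqrt_le_iff.2 ⟨by positivity, ?_⟩
  simp only [Fin.sum_univ_two, Matrix.cons_val_zero, Matrix.cons_val_one, Real.norm_eq_abs]
  nlinarith [abs_nonneg a, abs_nonneg b, mul_nonneg (abs_nonneg a) (abs_nonneg b)]

theorem lipschitzWith_graphMap (e : Plane ≃ₗᵢ[ℝ] Plane) (hγ : LipschitzWith K γ) :
    LipschitzWith (1 + K) (graphMap e γ) := by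
  refine LipschitzWith.of_dist_le_mul fun s t => ?_
  rw [graphMap, graphMap, e.symm.dist_map, dist_eq_norm,
    show (!₂[s, γ s] : Plane) - !₂[t, γ t] = !₂[s - t, γ s - γ t] by
      ext i; fin_cases i <;> simp]
  refine (norm_toLp_pair_le _ _).trans ?_
  have := hγ.dist_le_mul s t
  simp only [Real.dist_eq] at this ⊢
  push_cast
  linarith

theorem graphMap_add_up (e : Plane ≃ₗᵢ[ℝ] Plane) (γ : ℝ → ℝ) (s t : ℝ) :
    graphMap e γ s + t • up e = e.symm !₂[s, γ s + t] := by
  rw [graphMap, up, ← map_smul, ← map_add]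
  congr 1
  ext i; fin_cases i <;> simp

/-- The coordinates given by the abscissa and the height above the graph preserve the area. -/
theorem measurePreserving_graph_add_up (e : Plane ≃ₗᵢ[ℝ] Plane) (hγ : Continuous γ) :
    MeasurePreserving (fun p : ℝ × ℝ => graphMap e γ p.1 + p.2 • up e) := by
  -- A vertical shear: each fibre is merely translated. The other factors are coordinate
  -- identifications and an isometry.
  have h1 : MeasurePreserving (fun p : ℝ × ℝ => (p.1, γ p.1 + p.2)) :=
    (MeasurePreserving.id volume).skew_product (g := fun a b => γ a + b)
      (by fun_prop) (Eventually.of_forall fun a => map_add_left_eq_self volume (γ a))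
  have h2 := (volume_preserving_finTwoArrow ℝ).symm
  have h3 := (EuclideanSpace.volume_preserving_symm_measurableEquiv_toLp (Fin 2)).symm
  have h4 := e.symm.measurePreserving.comp (h3.comp (h2.comp h1))
  convert h4 using 2 with p
  rw [graphMap_add_up]
  rfl

theorem lintegral_strip_le (hΩ : MeasurableSet Ω) (hγ : Continuous γ) {I J : Set ℝ}
    (hI : MeasurableSet I) (hJ : MeasurableSet J)
    (h : ∀ s ∈ I, ∀ t ∈ J, graphMap e γ s + t • up e ∈ Ω) {f : Plane → ℝ≥0∞}
    (hf : Measurable f) :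
    ∫⁻ s in I, ∫⁻ t in J, f (graphMap e γ s + t • up e) ≤ ∫⁻ x in Ω, f x := by
  have hmp := measurePreserving_graph_add_up e hγ
  calc ∫⁻ s in I, ∫⁻ t in J, f (graphMap e γ s + t • up e)
      ≤ ∫⁻ s in I, ∫⁻ t in J, Ω.indicator f (graphMap e γ s + t • up e) :=
        setLIntegral_mono' hI fun s hs => setLIntegral_mono' hJ fun t ht => by
          rw [Set.indicator_of_mem (h s hs t ht)]
    _ ≤ ∫⁻ s, ∫⁻ t, Ω.indicator f (graphMap e γ s + t • up e) :=
        (setLIntegral_le_lintegral _ _).trans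
          (lintegral_mono fun s => setLIntegral_le_lintegral _ _)
    _ = ∫⁻ p : ℝ × ℝ, Ω.indicator f (graphMap e γ p.1 + p.2 • up e) := by
        exact (lintegral_prod _ ((hf.indicator hΩ).comp hmp.measurable).aemeasurable).symm
    _ = ∫⁻ x in Ω, f x := by
        rw [hmp.lintegral_comp (hf.indicator hΩ), lintegral_indicator hΩ]

/-- The trace inequality on a piece of a graph. -/
theorem lintegral_graphMap_le (hΩ : MeasurableSet Ω) (hγ : Continuous γ) {I : Set ℝ}
    (hI : MeasurableSet I) {h : ℝ}
    (hst : ∀ s ∈ I, ∀ t ∈ Set.Ioc 0 h, graphMap e γ s + t • up e ∈ Ω) {w : Plane → ℝ}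
    (hw : ContDiff ℝ 1 w) :
    ENNReal.ofReal h * ∫⁻ s in I, ‖w (graphMap e γ s)‖ₑ ^ 2 ≤
      2 * (∫⁻ x in Ω, ‖w x‖ₑ ^ 2) +
        2 * ENNReal.ofReal h ^ 2 * ∫⁻ x in Ω, ‖fderiv ℝ w x‖ₑ ^ 2 := by
  set H := ENNReal.ofReal h with hH
  have hwc := hw.continuous
  have hm1 : Measurable fun x => ‖w x‖ₑ ^ 2 := hwc.enorm.measurable.pow_const 2
  have hm2 : Measurable fun x => ‖fderiv ℝ w x‖ₑ ^ 2 :=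
    (continuous_fderiv_comp hw).enorm.measurable.pow_const 2
  have hmp := (measurePreserving_graph_add_up e hγ).measurable
  have hm1' : ∀ s, Measurable fun t : ℝ => ‖w (graphMap e γ s + t • up e)‖ₑ ^ 2 := fun s =>
    (by fun_prop : Continuous fun t : ℝ =>
      w (graphMap e γ s + t • up e)).enorm.measurable.pow_const 2
  -- The boundary value differs from the value at height t by an increment bounded by the energy on
  -- the vertical segment; integrate the squares over 0 < t ≤ h.
  have hpt : ∀ s, H * ‖w (graphMap e γ s)‖ₑ ^ 2 ≤
      2 * (∫⁻ t in Set.Ioc 0 h, ‖w (graphMap e γ s + t • up e)‖ₑ ^ 2) +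
        2 * H ^ 2 * ∫⁻ t in Set.Ioc 0 h, ‖fderiv ℝ w (graphMap e γ s + t • up e)‖ₑ ^ 2 := by
    intro s
    set E := ∫⁻ t in Set.Ioc 0 h, ‖fderiv ℝ w (graphMap e γ s + t • up e)‖ₑ ^ 2
    calc H * ‖w (graphMap e γ s)‖ₑ ^ 2
        = ∫⁻ _ in Set.Ioc 0 h, ‖w (graphMap e γ s)‖ₑ ^ 2 := by simp [hH, mul_comm]
      _ ≤ ∫⁻ t in Set.Ioc 0 h, (2 * ‖w (graphMap e γ s + t • up e)‖ₑ ^ 2 + 2 * (H * E)) := by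
          refine setLIntegral_mono' measurableSet_Ioc fun t ht => ?_
          calc ‖w (graphMap e γ s)‖ₑ ^ 2
              ≤ (‖w (graphMap e γ s + t • up e)‖ₑ +
                ‖w (graphMap e γ s + t • up e) - w (graphMap e γ s)‖ₑ) ^ 2 := by
                gcongr
                calc ‖w (graphMap e γ s)‖ₑ = ‖w (graphMap e γ s + t • up e) -
                    (w (graphMap e γ s + t • up e) - w (graphMap e γ s))‖ₑ := by
                      rw [sub_sub_cancel]
                  _ ≤ _ := enorm_sub_le
            _ ≤ _ := ennreal_add_sq_le _ _
            _ ≤ _ := by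
                gcongr
                refine (enorm_increment_sq_le hw _ _ ht.1.le).trans ?_
                have : ‖up e‖ₑ = 1 := by rw [← ofReal_norm, norm_up, ENNReal.ofReal_one]
                rw [this, one_pow, one_mul]
                refine mul_le_mul' (ENNReal.ofReal_le_ofReal ht.2)
                  (lintegral_mono_set (Set.Ioc_subset_Ioc_right ht.2))
      _ = _ := by
          rw [lintegral_add_right _ measurable_const,
            lintegral_const_mul 2 (hm1' s), lintegral_const]
          simp only [MeasurableSet.univ, Measure.restrict_apply, Set.univ_inter, Real.volume_Ioc,
            sub_zero, ← hH]
          ring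
  have hmm1 : Measurable fun s =>
      ∫⁻ t in Set.Ioc 0 h, ‖w (graphMap e γ s + t • up e)‖ₑ ^ 2 :=
    (hm1.comp hmp).lintegral_prod_right'
  have hmm2 : Measurable fun s =>
      ∫⁻ t in Set.Ioc 0 h, ‖fderiv ℝ w (graphMap e γ s + t • up e)‖ₑ ^ 2 :=
    (hm2.comp hmp).lintegral_prod_right'
  have hgm : Measurable fun s => ‖w (graphMap e γ s)‖ₑ ^ 2 := by
    simpa [Function.comp_def] using
      hm1.comp (hmp.comp (measurable_id.prodMk (measurable_const (a := (0 : ℝ)))))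
  rw [← lintegral_const_mul _ hgm]
  refine (lintegral_mono hpt).trans ?_
  rw [lintegral_add_left (hmm1.const_mul 2), lintegral_const_mul _ hmm1,
    lintegral_const_mul _ hmm2]
  exact add_le_add
    (mul_le_mul_right (lintegral_strip_le hΩ hγ hI measurableSet_Ioc hst hm1) _)
    (mul_le_mul_right (lintegral_strip_le hΩ hγ hI measurableSet_Ioc hst hm2) _)

/-- The trace inequality near a boundary point. -/
theorem exists_nhds_trace_le (hΩ : IsOpen Ω) (hx : x ∈ frontier Ω) (hγ : LipschitzWith K γ)
    (hr : 0 < r) (h : ∀ y ∈ Metric.ball x r, y ∈ Ω ↔ γ (e y 0) < e y 1) :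
    ∃ U ∈ 𝓝 x, ∃ C : ℝ≥0, ∀ w : Plane → ℝ, ContDiff ℝ 1 w →
      ∫⁻ y in U ∩ frontier Ω, ‖w y‖ₑ ^ 2 ∂(Measure.hausdorffMeasure 1) ≤
        C * ((∫⁻ x in Ω, ‖w x‖ₑ ^ 2) + ∫⁻ x in Ω, ‖fderiv ℝ w x‖ₑ ^ 2) := by
  -- Since (1+K)δ = r/4, the graph over I stays within r/4 of x, and climbing by at most r/2 does
  -- not leave the ball of radius r.
  set δ := r / (4 * (1 + (K : ℝ))) with hδ
  have hK : 0 < 1 + (K : ℝ) := by positivity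
  have hδ0 : 0 < δ := by positivity
  have hδK : (1 + (K : ℝ)) * δ = r / 4 := by rw [hδ]; field_simp
  have hδr : δ ≤ r / 4 := by nlinarith [mul_nonneg K.2 hδ0.le]
  set I := Metric.ball (e x 0) δ with hI
  have hxg := eq_graphMap_of_mem_frontier hΩ hγ.continuous h (Metric.mem_ball_self hr) hx
  have hst : ∀ s ∈ I, ∀ t ∈ Set.Ioc 0 (r / 2), graphMap e γ s + t • up e ∈ Ω := by
    intro s hs t ht
    rw [h, apply_add_up_zero, apply_add_up_one]
    · simp only [graphMap, LinearIsometryEquiv.apply_symm_apply]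
      simpa using ht.1
    · rw [Metric.mem_ball]
      calc dist (graphMap e γ s + t • up e) x
          ≤ dist (graphMap e γ s + t • up e) (graphMap e γ s) + dist (graphMap e γ s) x :=
            dist_triangle _ _ _
        _ ≤ t + (1 + K) * δ := by
            refine add_le_add ?_ ?_
            · rw [dist_self_add_left, norm_smul, norm_up, mul_one, Real.norm_of_nonneg ht.1.le]
            · conv_lhs => rw [hxg]
              refine ((lipschitzWith_graphMap e hγ).dist_le_mul _ _).trans ?_
              push_cast
              exact mul_le_mul_of_nonneg_left (Metric.mem_ball.1 hs).le hK.le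
        _ < r := by rw [hδK]; linarith [ht.2]
  have hsub : Metric.ball x δ ∩ frontier Ω ⊆ graphMap e γ '' I := by
    rintro y ⟨hy, hyf⟩
    refine ⟨e y 0, ?_, (eq_graphMap_of_mem_frontier hΩ hγ.continuous h
      (Metric.ball_subset_ball (by linarith) hy) hyf).symm⟩
    rw [hI, Metric.mem_ball, dist_eq_norm]
    rw [Metric.mem_ball, dist_eq_norm] at hy
    calc ‖e y 0 - e x 0‖ = ‖e (y - x) 0‖ := by simp
      _ ≤ ‖e (y - x)‖ := PiLp.norm_apply_le _ _
      _ = ‖y - x‖ := e.norm_map _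
      _ < δ := hy
  set H := (r / 2).toNNReal with hHdef
  have hH0 : (H : ℝ≥0∞) ≠ 0 := by simp [hHdef, hr]
  -- The factor 1+K is the Lipschitz constant of the graph map; the rest comes from dividing the
  -- strip estimate by its height H = r/2.
  refine ⟨_, Metric.ball_mem_nhds x hδ0, (1 + K) * (H⁻¹ * (2 + 2 * H ^ 2)), fun w hw => ?_⟩
  have hm : Measurable fun x => ‖w x‖ₑ ^ 2 := hw.continuous.enorm.measurable.pow_const 2
  have h1 := setLIntegral_hausdorffMeasure_le (lipschitzWith_graphMap e hγ) hsub hm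
  have h2 := lintegral_graphMap_le hΩ.measurableSet hγ.continuous measurableSet_ball
    hst hw
  rw [show ENNReal.ofReal (r / 2) = (H : ℝ≥0∞) from rfl] at h2
  refine h1.trans ?_
  rw [ENNReal.coe_mul, mul_assoc]
  refine mul_le_mul_right ?_ _
  have hH' : H ≠ 0 := by simpa using hH0
  rw [ENNReal.coe_mul, ENNReal.coe_inv hH', mul_assoc, ← ENNReal.div_eq_inv_mul,
    ENNReal.le_div_iff_mul_le (Or.inl hH0) (Or.inl ENNReal.coe_ne_top), mul_comm]
  refine h2.trans ?_
  push_cast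
  rw [mul_add]
  gcongr
  · exact le_self_add
  · exact le_add_self

end Chart

/-- The trace inequality on a bounded Lipschitz domain. -/
theorem IsLipschitzDomain.exists_trace_le {Ω : Set Plane} (hΩ : IsLipschitzDomain Ω) :
    ∃ C : ℝ≥0, ∀ w : Plane → ℝ, ContDiff ℝ 1 w →
      ∫⁻ y, ‖w y‖ₑ ^ 2 ∂(surf Ω) ≤
        C * ((∫⁻ x in Ω, ‖w x‖ₑ ^ 2) + ∫⁻ x in Ω, ‖fderiv ℝ w x‖ₑ ^ 2) := by
  have hcomp : IsCompact (frontier Ω) :=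
    hΩ.isBounded.isCompact_closure.of_isClosed_subset isClosed_frontier frontier_subset_closure
  have := hcomp.induction_on (p := fun s => ∃ C : ℝ≥0, ∀ w : Plane → ℝ, ContDiff ℝ 1 w →
    ∫⁻ y in s ∩ frontier Ω, ‖w y‖ₑ ^ 2 ∂(Measure.hausdorffMeasure 1) ≤
      C * ((∫⁻ x in Ω, ‖w x‖ₑ ^ 2) + ∫⁻ x in Ω, ‖fderiv ℝ w x‖ₑ ^ 2)) ⟨0, by simp⟩ ?_ ?_ ?_
  · rw [Set.inter_self] at this
    exact this
  · rintro s t hst ⟨C, hC⟩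
    exact ⟨C, fun w hw => (lintegral_mono_set (Set.inter_subset_inter_left _ hst)).trans (hC w hw)⟩
  · rintro s t ⟨C, hC⟩ ⟨C', hC'⟩
    refine ⟨C + C', fun w hw => ?_⟩
    rw [Set.union_inter_distrib_right, ENNReal.coe_add, add_mul]
    exact (lintegral_union_le _ _ _).trans (add_le_add (hC w hw) (hC' w hw))
  · intro x hx
    obtain ⟨e, γ, K, r, hγ, hr, h⟩ := hΩ.chart x hx
    obtain ⟨U, hU, hC⟩ := exists_nhds_trace_le hΩ.isOpen hx hγ hr h
    exact ⟨U, mem_nhdsWithin_of_mem_nhds hU, hC⟩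

/-! ### Poincaré and Friedrichs inequalities -/

theorem eLpNorm_two_sq {X E : Type*} [MeasurableSpace X] [NormedAddCommGroup E] (f : X → E)
    (μ : Measure X) : eLpNorm f 2 μ ^ 2 = ∫⁻ x, ‖f x‖ₑ ^ 2 ∂μ := by
  have := eLpNorm_nnreal_pow_eq_lintegral (f := f) (μ := μ) (p := 2) two_ne_zero
  simpa using this

/-- The factor 1+C avoids the square root of C, as C ≤ (1+C)². -/
theorem eLpNorm_le_of_lintegral_sq_le {X Y E F : Type*} [MeasurableSpace X] [MeasurableSpace Y]
    [NormedAddCommGroup E] [NormedAddCommGroup F] {μ : Measure X} {ν : Measure Y} {f : X → E}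
    {g : Y → F} {C : ℝ≥0} (h : ∫⁻ x, ‖f x‖ₑ ^ 2 ∂μ ≤ C * ∫⁻ y, ‖g y‖ₑ ^ 2 ∂ν) :
    eLpNorm f 2 μ ≤ (1 + C : ℝ≥0) * eLpNorm g 2 ν := by
  rw [← eLpNorm_two_sq, ← eLpNorm_two_sq] at h
  have h1 : eLpNorm f 2 μ ^ 2 ≤ ((1 + C : ℝ≥0) * eLpNorm g 2 ν) ^ 2 := by
    refine h.trans ?_
    rw [mul_pow]
    gcongr
    norm_cast
    nlinarith [C.2, sq_nonneg C]
  exact (ENNReal.pow_le_pow_left_iff two_ne_zero).1 h1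

theorem enorm_gradient (w : Plane → ℝ) (x : Plane) : ‖gradient w x‖ₑ = ‖fderiv ℝ w x‖ₑ := by
  rw [gradient]
  exact ((InnerProductSpace.toDual ℝ Plane).symm.enorm_map _)

theorem eLpNorm_const_two {X : Type*} [MeasurableSpace X] (μ : Measure X) [IsFiniteMeasure μ]
    (c : ℝ) : eLpNorm (fun _ => c) 2 μ = ‖c‖ₑ * μ Set.univ ^ (1 / 2 : ℝ) := by
  simp [eLpNorm_const' c (p := 2) (by norm_num) (by norm_num) (μ := μ)]

namespace IsLipschitzDomain

variable {Ω : Set Plane}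

/-- Apply the trace inequality to the constant 1: its energy is zero and Ω has finite area. -/
theorem isFiniteMeasure_surf (hΩ : IsLipschitzDomain Ω) : IsFiniteMeasure (surf Ω) := by
  obtain ⟨C, hC⟩ := hΩ.exists_trace_le
  have := hC (fun _ => 1) contDiff_const
  have h0 : ‖(0 : Plane →L[ℝ] ℝ)‖ₑ = 0 := by rw [← ofReal_norm, norm_zero, ENNReal.ofReal_zero]
  refine ⟨lt_of_le_of_lt (by simpa using this) ?_⟩
  exact ENNReal.mul_lt_top ENNReal.coe_lt_top
    (by simpa [h0] using hΩ.isBounded.measure_lt_top (μ := volume))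

theorem isFiniteMeasure_restrict (hΩ : IsLipschitzDomain Ω) :
    IsFiniteMeasure (volume.restrict Ω) :=
  ⟨by simpa using hΩ.isBounded.measure_lt_top⟩

/-- The Poincaré inequality, together with the trace inequality, modulo constants. -/
theorem exists_poincare (hΩ : IsLipschitzDomain Ω) :
    ∃ C : ℝ≥0, ∀ w : Plane → ℝ, ContDiff ℝ 1 w → ∃ c : ℝ,
      eLpNorm (fun x => w x - c) 2 (volume.restrict Ω) ≤
        C * eLpNorm (gradient w) 2 (volume.restrict Ω) ∧
      eLpNorm (fun x => w x - c) 2 (surf Ω) ≤ C * eLpNorm (gradient w) 2 (volume.restrict Ω) := by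
  obtain ⟨x₀, hx₀⟩ := hΩ.isConnected.nonempty
  obtain ⟨r, hr, hB⟩ := Metric.isOpen_iff.1 hΩ.isOpen x₀ hx₀
  obtain ⟨C₁, h₁⟩ := exists_setLIntegral_ball_sub_sq_le hΩ.isOpen.measurableSet hr hB
  obtain ⟨C₂, h₂⟩ := hΩ.controls hr hx₀
  obtain ⟨C₃, h₃⟩ := hΩ.exists_trace_le
  -- A passes from the ball to Ω, and A' from Ω to the boundary, both for w - c.
  set A : ℝ≥0 := C₂ * (C₁ + 1) with hA
  set A' : ℝ≥0 := C₃ * (A + 1) with hA'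
  refine ⟨1 + A + (1 + A'), fun w hw => ?_⟩
  obtain ⟨c, hc⟩ := h₁ w hw
  have hw' : ContDiff ℝ 1 fun x => w x - c := hw.sub contDiff_const
  have hE : ∫⁻ x in Ω, ‖fderiv ℝ (fun x => w x - c) x‖ₑ ^ 2 =
      ∫⁻ x in Ω, ‖gradient w x‖ₑ ^ 2 := by
    simp only [fderiv_sub_const, enorm_gradient]
  have e₂ := h₂ _ hw'
  have e₃ := h₃ _ hw'
  rw [hE] at e₂ e₃
  simp only [← enorm_gradient] at hc
  set E := ∫⁻ x in Ω, ‖gradient w x‖ₑ ^ 2 with hEdef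
  have f₂ : ∫⁻ x in Ω, ‖w x - c‖ₑ ^ 2 ≤ A * E := by
    refine e₂.trans ?_
    rw [hA, ENNReal.coe_mul, mul_assoc]
    gcongr
    push_cast
    rw [add_mul, one_mul]
    gcongr
  have f₃ : ∫⁻ x, ‖w x - c‖ₑ ^ 2 ∂(surf Ω) ≤ A' * E := by
    refine e₃.trans ?_
    rw [hA', ENNReal.coe_mul, mul_assoc]
    gcongr
    push_cast
    rw [add_mul, one_mul]
    gcongr
  refine ⟨c, (eLpNorm_le_of_lintegral_sq_le f₂).trans ?_,
    (eLpNorm_le_of_lintegral_sq_le f₃).trans ?_⟩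
  · exact mul_le_mul_left (ENNReal.coe_le_coe.2 le_self_add) _
  · exact mul_le_mul_left (ENNReal.coe_le_coe.2 le_add_self) _

/-- The Poincaré–Friedrichs inequality, with the trace on a part `Γ` of the boundary. -/
theorem exists_friedrichs (hΩ : IsLipschitzDomain Ω) {Γ : Set Plane} (hΓ : 0 < surf Ω Γ) :
    ∃ C : ℝ≥0, ∀ w : Plane → ℝ, ContDiff ℝ 1 w →
      eLpNorm w 2 (volume.restrict Ω) ≤ C * (eLpNorm (gradient w) 2 (volume.restrict Ω) +
        eLpNorm w 2 ((surf Ω).restrict Γ)) ∧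
      eLpNorm w 2 (surf Ω) ≤ C * (eLpNorm (gradient w) 2 (volume.restrict Ω) +
        eLpNorm w 2 ((surf Ω).restrict Γ)) := by
  have := hΩ.isFiniteMeasure_surf
  have := hΩ.isFiniteMeasure_restrict
  obtain ⟨C, hC⟩ := hΩ.exists_poincare
  set m : ℝ≥0∞ := surf Ω Γ ^ (1 / 2 : ℝ) with hm
  have hm0 : m ≠ 0 := by simp [hm, hΓ.ne']
  have hm1 : m ≠ ⊤ := by simp [hm]
  have main : ∀ (μ : Measure Plane) [IsFiniteMeasure μ], ∃ C' : ℝ≥0, ∀ (w : Plane → ℝ) (c : ℝ)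
      (G : ℝ≥0∞), ContDiff ℝ 1 w → eLpNorm (fun x => w x - c) 2 μ ≤ C * G →
      eLpNorm (fun x => w x - c) 2 (surf Ω) ≤ C * G →
      eLpNorm w 2 μ ≤ C' * (G + eLpNorm w 2 ((surf Ω).restrict Γ)) := by
    intro μ _
    refine ⟨(C + (m⁻¹ * (1 + C)) * μ Set.univ ^ (1 / 2 : ℝ)).toNNReal, fun w c G hw h h' => ?_⟩
    have hfin : (C + (m⁻¹ * (1 + C)) * μ Set.univ ^ (1 / 2 : ℝ)) ≠ ⊤ := by
      have := ENNReal.inv_ne_top.2 hm0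
      finiteness
    rw [ENNReal.coe_toNNReal hfin]
    set D := eLpNorm w 2 ((surf Ω).restrict Γ)
    have hwc := hw.continuous
    -- The constant is measured on Γ, where its L² norm is |c|·σ(Γ)^{1/2} and c = w - (w - c).
    have hc : ‖c‖ₑ ≤ m⁻¹ * (1 + C) * (G + D) := by
      have h1 : ‖c‖ₑ * m ≤ (1 + C) * (G + D) := by
        calc ‖c‖ₑ * m = eLpNorm (fun _ => c) 2 ((surf Ω).restrict Γ) := by
              rw [eLpNorm_const_two, Measure.restrict_apply_univ]
          _ = eLpNorm (w - fun x => w x - c) 2 ((surf Ω).restrict Γ) := by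
              congr 1; ext x; simp
          _ ≤ D + eLpNorm (fun x => w x - c) 2 ((surf Ω).restrict Γ) :=
              eLpNorm_sub_le hwc.aestronglyMeasurable
                (hwc.sub continuous_const).aestronglyMeasurable (by norm_num)
          _ ≤ D + C * G := by
              gcongr
              exact (eLpNorm_mono_measure _ Measure.restrict_le_self).trans h'
          _ ≤ (1 + C) * (G + D) := by
              rw [add_mul, one_mul]
              exact add_le_add le_add_self (mul_le_mul_right le_self_add _)
      rw [mul_assoc, ← ENNReal.div_eq_inv_mul,
        ENNReal.le_div_iff_mul_le (Or.inl hm0) (Or.inl hm1)]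
      exact h1
    calc eLpNorm w 2 μ = eLpNorm ((fun x => w x - c) + fun _ => c) 2 μ := by
          congr 1; ext x; simp
      _ ≤ eLpNorm (fun x => w x - c) 2 μ + eLpNorm (fun _ => c) 2 μ :=
          eLpNorm_add_le (hwc.sub continuous_const).aestronglyMeasurable
            aestronglyMeasurable_const (by norm_num)
      _ ≤ C * (G + D) + m⁻¹ * (1 + C) * (G + D) * μ Set.univ ^ (1 / 2 : ℝ) := by
          rw [eLpNorm_const_two]
          gcongr
          exact h.trans (mul_le_mul_right le_self_add _)
      _ = _ := by ring
  obtain ⟨C₁, h₁⟩ := main (volume.restrict Ω)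
  obtain ⟨C₂, h₂⟩ := main (surf Ω)
  refine ⟨C₁ + C₂, fun w hw => ?_⟩
  obtain ⟨c, ha, hb⟩ := hC w hw
  refine ⟨(h₁ w c _ hw ha hb).trans ?_, (h₂ w c _ hw hb hb).trans ?_⟩
  · gcongr; exact le_self_add
  · gcongr; exact le_add_self

end IsLipschitzDomain

/-! ### V as a Hilbert space with continuous trace -/

/-- Triples of a function, a vector field on `Ω` and a function on the boundary. -/
abbrev Triple (Ω : Set Plane) : Type :=
  Lp ℝ 2 (volume.restrict Ω) × Lp Plane 2 (volume.restrict Ω) × Lp ℝ 2 (surf Ω)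

theorem gradient_add_of_contDiff {v w : Plane → ℝ} (hv : ContDiff ℝ ∞ v) (hw : ContDiff ℝ ∞ w)
    (x : Plane) : gradient (v + w) x = gradient v x + gradient w x := by
  have h := fderiv_add (𝕜 := ℝ) (hv.differentiable (by simp) x) (hw.differentiable (by simp) x)
  rw [gradient, h, map_add]
  rfl

theorem gradient_smul_of_contDiff {v : Plane → ℝ} (hv : ContDiff ℝ ∞ v) (c : ℝ)
    (x : Plane) : gradient (c • v) x = c • gradient v x := by
  rw [gradient, fderiv_const_smul (hv.differentiable (by simp) x)]
  simp [gradient]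

theorem continuous_gradient {w : Plane → ℝ} (hw : ContDiff ℝ ∞ w) : Continuous (gradient w) :=
  (InnerProductSpace.toDual ℝ Plane).symm.continuous.comp (hw.continuous_fderiv (by simp))

theorem hasCompactSupport_gradient {w : Plane → ℝ} (hw : HasCompactSupport w) :
    HasCompactSupport (gradient w) :=
  (hw.fderiv ℝ).comp_left (map_zero (InnerProductSpace.toDual ℝ Plane).symm)

/-- The triples `(w, ∇w, w|∂Ω)` of smooth functions `w`. -/
def smoothTriples (Ω : Set Plane) : Submodule ℝ (Triple Ω) where
  carrier := {p | ∃ w : Plane → ℝ, (ContDiff ℝ ∞ w ∧ HasCompactSupport w) ∧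
    p.1 =ᵐ[volume.restrict Ω] w ∧ p.2.1 =ᵐ[volume.restrict Ω] gradient w ∧ p.2.2 =ᵐ[surf Ω] w}
  zero_mem' := by
    refine ⟨0, ⟨contDiff_const, HasCompactSupport.zero⟩, Lp.coeFn_zero _ _ _, ?_,
      Lp.coeFn_zero _ _ _⟩
    refine (Lp.coeFn_zero _ _ _).trans (Eventually.of_forall fun x => ?_)
    simp [gradient]
  add_mem' := by
    rintro p q ⟨v, ⟨hv, hv'⟩, h1, h2, h3⟩ ⟨w, ⟨hw, hw'⟩, k1, k2, k3⟩
    refine ⟨v + w, ⟨hv.add hw, hv'.add hw'⟩, (Lp.coeFn_add _ _).trans (h1.add k1), ?_,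
      (Lp.coeFn_add _ _).trans (h3.add k3)⟩
    filter_upwards [Lp.coeFn_add p.2.1 q.2.1, h2, k2] with x h h2 k2
    rw [Prod.snd_add, Prod.fst_add, h, Pi.add_apply, h2, k2, gradient_add_of_contDiff hv hw]
  smul_mem' := by
    rintro c p ⟨v, ⟨hv, hv'⟩, h1, h2, h3⟩
    refine ⟨c • v, ⟨contDiff_const.smul hv, hv'.smul_left (f := fun _ => c)⟩,
      (Lp.coeFn_smul _ _).trans (h1.const_smul c), ?_,
      (Lp.coeFn_smul _ _).trans (h3.const_smul c)⟩
    filter_upwards [Lp.coeFn_smul c p.2.1, h2] with x h h2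
    rw [Prod.smul_snd, Prod.smul_fst, h, Pi.smul_apply, h2, gradient_smul_of_contDiff hv]

/-- This turns the existence of an approximating sequence into membership in a closed subspace,
which supplies both linearity and completeness of V. -/
theorem isTrace_iff_mem_closure {Ω : Set Plane} [IsFiniteMeasure (surf Ω)]
    [IsFiniteMeasure (volume.restrict Ω)] (u : H1 Ω) (t : Lp ℝ 2 (surf Ω)) :
    IsTrace u t ↔ (u.val, u.grad, t) ∈ (smoothTriples Ω).topologicalClosure := by
  rw [← SetLike.mem_coe, Submodule.topologicalClosure_coe, mem_closure_iff_seq_limit]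
  constructor
  · rintro ⟨w, hw, h1, h2, h3⟩
    have m1 : ∀ n, MemLp (w n) 2 (volume.restrict Ω) := fun n =>
      (hw n).1.continuous.memLp_of_hasCompactSupport (hw n).2
    have m2 : ∀ n, MemLp (gradient (w n)) 2 (volume.restrict Ω) := fun n =>
      (continuous_gradient (hw n).1).memLp_of_hasCompactSupport
        (hasCompactSupport_gradient (hw n).2)
    have m3 : ∀ n, MemLp (w n) 2 (surf Ω) := fun n =>
      (hw n).1.continuous.memLp_of_hasCompactSupport (hw n).2
    refine ⟨fun n => ((m1 n).toLp, (m2 n).toLp, (m3 n).toLp), fun n =>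
      ⟨w n, hw n, (m1 n).coeFn_toLp, (m2 n).coeFn_toLp, (m3 n).coeFn_toLp⟩, ?_⟩
    refine Tendsto.prodMk_nhds ?_ (Tendsto.prodMk_nhds ?_ ?_)
    · rw [Lp.tendsto_Lp_iff_tendsto_eLpNorm']
      refine h1.congr fun n => eLpNorm_congr_ae ?_
      filter_upwards [(m1 n).coeFn_toLp] with x hx
      simp [hx]
    · rw [Lp.tendsto_Lp_iff_tendsto_eLpNorm']
      refine h2.congr fun n => eLpNorm_congr_ae ?_
      filter_upwards [(m2 n).coeFn_toLp] with x hx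
      simp [hx]
    · rw [Lp.tendsto_Lp_iff_tendsto_eLpNorm']
      refine h3.congr fun n => eLpNorm_congr_ae ?_
      filter_upwards [(m3 n).coeFn_toLp] with x hx
      simp [hx]
  · rintro ⟨p, hp, hlim⟩
    choose w hw h1 h2 h3 using hp
    refine ⟨w, hw, ?_, ?_, ?_⟩
    · refine ((Lp.tendsto_Lp_iff_tendsto_eLpNorm' _ _).1 hlim.fst_nhds).congr fun n =>
        eLpNorm_congr_ae ?_
      filter_upwards [h1 n] with x hx
      simp [hx]
    · refine ((Lp.tendsto_Lp_iff_tendsto_eLpNorm' _ _).1 hlim.snd_nhds.fst_nhds).congr fun n =>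
        eLpNorm_congr_ae ?_
      filter_upwards [h2 n] with x hx
      simp [hx]
    · refine ((Lp.tendsto_Lp_iff_tendsto_eLpNorm' _ _).1 hlim.snd_nhds.snd_nhds).congr fun n =>
        eLpNorm_congr_ae ?_
      filter_upwards [h3 n] with x hx
      simp [hx]

/-- The two sides of the definition of the weak gradient are continuous functionals on `L²`. -/
theorem exists_inner_eq_weakGradient (Ω : Set Plane) {η : Plane → ℝ} (hη : ContDiff ℝ ∞ η)
    (hc : HasCompactSupport η) (e : Plane) :
    ∃ (a : Lp ℝ 2 (volume.restrict Ω)) (b : Lp Plane 2 (volume.restrict Ω)),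
      (∀ u : Lp ℝ 2 (volume.restrict Ω), ∫ x in Ω, u x * fderiv ℝ η x e = inner ℝ a u) ∧
      ∀ G : Lp Plane 2 (volume.restrict Ω), ∫ x in Ω, inner ℝ (G x) e * η x = inner ℝ b G := by
  have m1 : MemLp (fun x => fderiv ℝ η x e) 2 (volume.restrict Ω) :=
    ((hη.continuous_fderiv (by simp)).clm_apply continuous_const).memLp_of_hasCompactSupport
      (hc.fderiv_apply ℝ e)
  have m2 : MemLp (fun x => η x • e) 2 (volume.restrict Ω) :=
    (hη.continuous.smul continuous_const).memLp_of_hasCompactSupport hc.smul_right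
  refine ⟨m1.toLp, m2.toLp, fun u => ?_, fun G => ?_⟩
  · rw [L2.inner_def]
    refine integral_congr_ae ?_
    filter_upwards [m1.coeFn_toLp] with x hx
    rw [hx]
    simp
  · rw [L2.inner_def]
    refine integral_congr_ae ?_
    filter_upwards [m2.coeFn_toLp] with x hx
    rw [hx, real_inner_smul_left, real_inner_comm, mul_comm]

/-- The triples in which the vector field is the weak gradient of the function. -/
def weakGradientTriples (Ω : Set Plane) : Submodule ℝ (Triple Ω) where
  carrier := {p | IsWeakGradient Ω p.1 p.2.1}
  zero_mem' := by
    intro η hη hc _ e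
    obtain ⟨a, b, ha, hb⟩ := exists_inner_eq_weakGradient Ω hη hc e
    rw [ha, hb]
    simp
  add_mem' := by
    intro p q hp hq η hη hc hs e
    have h1 := hp η hη hc hs e
    have h2 := hq η hη hc hs e
    obtain ⟨a, b, ha, hb⟩ := exists_inner_eq_weakGradient Ω hη hc e
    rw [ha, hb] at h1 h2 ⊢
    rw [Prod.fst_add, Prod.snd_add, Prod.fst_add, inner_add_right, inner_add_right, h1, h2]
    ring
  smul_mem' := by
    intro c p hp η hη hc hs e
    have h1 := hp η hη hc hs e
    obtain ⟨a, b, ha, hb⟩ := exists_inner_eq_weakGradient Ω hη hc e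
    rw [ha, hb] at h1 ⊢
    rw [Prod.smul_fst, Prod.smul_snd, Prod.smul_fst, real_inner_smul_right,
      real_inner_smul_right, h1]
    ring

/-- Each test function and direction imposes equality of two continuous functionals. -/
theorem isClosed_weakGradientTriples (Ω : Set Plane) :
    IsClosed (weakGradientTriples Ω : Set (Triple Ω)) := by
  have : (weakGradientTriples Ω : Set (Triple Ω)) = ⋂ (η : Plane → ℝ) (_ : ContDiff ℝ ∞ η)
      (_ : HasCompactSupport η) (_ : tsupport η ⊆ Ω) (e : Plane),
      {p : Triple Ω | ∫ x in Ω, p.1 x * fderiv ℝ η x e = -∫ x in Ω, inner ℝ (p.2.1 x) e * η x} := by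
    ext p
    simp only [Set.mem_iInter]
    rfl
  rw [this]
  refine isClosed_iInter fun η => isClosed_iInter fun hη => isClosed_iInter fun hc =>
    isClosed_iInter fun _ => isClosed_iInter fun e => ?_
  obtain ⟨a, b, ha, hb⟩ := exists_inner_eq_weakGradient Ω hη hc e
  simp only [ha, hb]
  exact isClosed_eq (by fun_prop) (by fun_prop)

/-- The triples `(v, ∇v, v|∂Ω)` with `v ∈ V`. -/
def tripleV (Ω ΓD : Set Plane) : Submodule ℝ (Triple Ω) :=
  (smoothTriples Ω).topologicalClosure ⊓ weakGradientTriples Ω ⊓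
    ((LpToLpRestrictCLM Plane ℝ ℝ (surf Ω) 2 ΓD).comp
      ((ContinuousLinearMap.snd ℝ _ _).comp (ContinuousLinearMap.snd ℝ _ _))).ker

theorem mem_tripleV {Ω ΓD : Set Plane} {p : Triple Ω} :
    p ∈ tripleV Ω ΓD ↔ (p ∈ (smoothTriples Ω).topologicalClosure ∧ IsWeakGradient Ω p.1 p.2.1) ∧
      ∀ᵐ x ∂(surf Ω).restrict ΓD, p.2.2 x = 0 := by
  rw [tripleV, Submodule.mem_inf, Submodule.mem_inf]
  refine and_congr (and_congr_right fun _ => Iff.rfl) ?_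
  rw [LinearMap.mem_ker]
  change LpToLpRestrictCLM Plane ℝ ℝ (surf Ω) 2 ΓD p.2.2 = 0 ↔ _
  have h := LpToLpRestrictCLM_coeFn ℝ (p := 2) ΓD p.2.2
  rw [Lp.eq_zero_iff_ae_eq_zero]
  constructor
  · intro h0
    filter_upwards [h, h0] with x h h0
    rw [← h, h0]; rfl
  · intro h0
    filter_upwards [h, h0] with x h h0
    rw [h, h0]; rfl

theorem isClosed_tripleV (Ω ΓD : Set Plane) : IsClosed (tripleV Ω ΓD : Set (Triple Ω)) := by
  refine ((Submodule.isClosed_topologicalClosure _).inter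
    (isClosed_weakGradientTriples Ω)).inter ?_
  exact ContinuousLinearMap.isClosed_ker _

/-- An element of `V` is the same as its triple. -/
def equivTripleV (Ω ΓD : Set Plane) [IsFiniteMeasure (surf Ω)]
    [IsFiniteMeasure (volume.restrict Ω)] : V Ω ΓD ≃ tripleV Ω ΓD where
  toFun v := ⟨(v.val, v.grad, v.trace), mem_tripleV.2
    ⟨⟨(isTrace_iff_mem_closure _ _).1 v.isTrace, v.isWeakGradient⟩, v.trace_eq_zero⟩⟩
  invFun p :=
    { val := p.1.1
      grad := p.1.2.1
      isWeakGradient := (mem_tripleV.1 p.2).1.2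
      trace := p.1.2.2
      isTrace := (isTrace_iff_mem_closure _ _).2 (mem_tripleV.1 p.2).1.1
      trace_eq_zero := (mem_tripleV.1 p.2).2 }
  left_inv _ := rfl
  right_inv _ := rfl

theorem norm_Lp_eq_of_ae_eq {X E : Type*} [MeasurableSpace X] [NormedAddCommGroup E]
    {μ : Measure X} {f : Lp E 2 μ} {g : X → E} (h : f =ᵐ[μ] g) : ‖f‖ = (eLpNorm g 2 μ).toReal := by
  rw [Lp.norm_def, eLpNorm_congr_ae h]

/-- A closed subspace on which a continuous linear map is bounded below is identified with its
image. -/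
theorem exists_equiv_range {E F K : Type*} [NormedAddCommGroup E] [NormedSpace ℝ E]
    [CompleteSpace E] [NormedAddCommGroup F] [NormedSpace ℝ F] [CompleteSpace F]
    [NormedAddCommGroup K] [NormedSpace ℝ K] {Z : Submodule ℝ E} (hZ : IsClosed (Z : Set E))
    (G : E →L[ℝ] F) (T : E →L[ℝ] K) {C : ℝ≥0} (hC : ∀ p ∈ Z, ‖p‖ ≤ C * ‖G p‖) :
    ∃ (H : Submodule ℝ F) (S : H →L[ℝ] K) (f : Z ≃ H), IsClosed (H : Set F) ∧
      (∀ z, (f z : F) = G z) ∧ ∀ z, S (f z) = T z := by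
  have : CompleteSpace Z := hZ.completeSpace_coe
  -- A map bounded below on a complete space has closed range and a continuous inverse on it.
  have hG : AntilipschitzWith C (G.comp Z.subtypeL) :=
    (G.comp Z.subtypeL).antilipschitz_of_bound fun p => hC p p.2
  have hcl := hG.isClosed_range (G.comp Z.subtypeL).uniformContinuous
  refine ⟨_, (T.comp Z.subtypeL).comp
    ((ContinuousLinearMap.equivRange hG.injective hcl).symm : _ →L[ℝ] Z),
    (ContinuousLinearMap.equivRange hG.injective hcl).toEquiv, hcl, fun _ => rfl, fun z => ?_⟩
  exact congrArg (fun z : Z => T z)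
    ((ContinuousLinearMap.equivRange hG.injective hcl).symm_apply_apply z)

namespace IsLipschitzDomain

variable {Ω ΓD : Set Plane}

/-- The Poincaré–Friedrichs and trace inequalities in `V`. -/
theorem exists_norm_le_norm_grad (hΩ : IsLipschitzDomain Ω) (hD : 0 < surf Ω ΓD) :
    ∃ C : ℝ≥0, ∀ p ∈ tripleV Ω ΓD, ‖p.1‖ ≤ C * ‖p.2.1‖ ∧ ‖p.2.2‖ ≤ C * ‖p.2.1‖ := by
  have := hΩ.isFiniteMeasure_surf
  have := hΩ.isFiniteMeasure_restrict
  obtain ⟨C, hC⟩ := hΩ.exists_friedrichs hD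
  refine ⟨C, fun p hp => ?_⟩
  set R := LpToLpRestrictCLM Plane ℝ ℝ (surf Ω) 2 ΓD
  -- The Friedrichs inequality is a closed condition on triples, so it extends from smooth triples
  -- to their closure; on V the term on Γ_D vanishes.
  have hclosed : IsClosed {p : Triple Ω | ‖p.1‖ ≤ C * (‖p.2.1‖ + ‖R p.2.2‖) ∧
      ‖p.2.2‖ ≤ C * (‖p.2.1‖ + ‖R p.2.2‖)} :=
    (isClosed_le (by fun_prop) (by fun_prop)).and (isClosed_le (by fun_prop) (by fun_prop))
  have hsub : (smoothTriples Ω : Set (Triple Ω)) ⊆ {p : Triple Ω |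
      ‖p.1‖ ≤ C * (‖p.2.1‖ + ‖R p.2.2‖) ∧ ‖p.2.2‖ ≤ C * (‖p.2.1‖ + ‖R p.2.2‖)} := by
    rintro q ⟨w, ⟨hw, hwc⟩, h1, h2, h3⟩
    have h4 : R q.2.2 =ᵐ[(surf Ω).restrict ΓD] w :=
      (LpToLpRestrictCLM_coeFn ℝ ΓD q.2.2).trans (ae_restrict_of_ae h3)
    obtain ⟨k1, k2⟩ := hC w (hw.of_le (by simp))
    rw [Set.mem_ofPred_eq, norm_Lp_eq_of_ae_eq h1, norm_Lp_eq_of_ae_eq h2,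
      norm_Lp_eq_of_ae_eq h3, norm_Lp_eq_of_ae_eq h4]
    have m2 : eLpNorm (gradient w) 2 (volume.restrict Ω) ≠ ⊤ := by
      rw [← eLpNorm_congr_ae h2]; exact Lp.eLpNorm_ne_top _
    have m4 : eLpNorm w 2 ((surf Ω).restrict ΓD) ≠ ⊤ := by
      rw [← eLpNorm_congr_ae h4]; exact Lp.eLpNorm_ne_top _
    have hfin : C * (eLpNorm (gradient w) 2 (volume.restrict Ω) +
        eLpNorm w 2 ((surf Ω).restrict ΓD)) ≠ ⊤ := by finiteness
    have e := ENNReal.toReal_add m2 m4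
    have k1' := ENNReal.toReal_mono hfin k1
    have k2' := ENNReal.toReal_mono hfin k2
    rw [ENNReal.toReal_mul, ENNReal.coe_toReal, e] at k1' k2'
    exact ⟨k1', k2'⟩
  have hp' := closure_minimal hsub hclosed hp.1.1
  have hR : R p.2.2 = 0 := hp.2
  simpa [hR] using hp'

/-- The space `V` is, through the gradient, a closed subspace of `L²`, on which the trace is a
continuous linear map. -/
theorem exists_equiv_submodule (hΩ : IsLipschitzDomain Ω) (hD : 0 < surf Ω ΓD) :
    ∃ (H : Submodule ℝ (Lp Plane 2 (volume.restrict Ω))) (T : H →L[ℝ] Lp ℝ 2 (surf Ω))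
      (f : V Ω ΓD ≃ H), IsClosed (H : Set (Lp Plane 2 (volume.restrict Ω))) ∧
        (∀ v, (f v : Lp Plane 2 (volume.restrict Ω)) = v.grad) ∧ ∀ v, T (f v) = v.trace := by
  have := hΩ.isFiniteMeasure_surf
  have := hΩ.isFiniteMeasure_restrict
  obtain ⟨C, hC⟩ := hΩ.exists_norm_le_norm_grad hD
  obtain ⟨H, S, f, hcl, h1, h2⟩ := exists_equiv_range (isClosed_tripleV Ω ΓD)
    ((ContinuousLinearMap.fst ℝ (Lp Plane 2 (volume.restrict Ω)) (Lp ℝ 2 (surf Ω))).comp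
      (ContinuousLinearMap.snd ℝ (Lp ℝ 2 (volume.restrict Ω)) _))
    ((ContinuousLinearMap.snd ℝ (Lp Plane 2 (volume.restrict Ω)) (Lp ℝ 2 (surf Ω))).comp
      (ContinuousLinearMap.snd ℝ (Lp ℝ 2 (volume.restrict Ω)) _)) (C := 1 + C) fun p hp => by
        obtain ⟨h1, h2⟩ := hC p hp
        have h0 : 0 ≤ ‖p.2.1‖ := norm_nonneg _
        change ‖p‖ ≤ _ * ‖p.2.1‖
        push_cast
        rw [Prod.norm_def, Prod.norm_def]
        refine max_le (by linarith) (max_le ?_ (by linarith))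
        nlinarith [mul_nonneg C.2 h0]
  exact ⟨H, S, (equivTripleV Ω ΓD).trans f, hcl, fun v => h1 (equivTripleV Ω ΓD v),
    fun v => h2 (equivTripleV Ω ΓD v)⟩

end IsLipschitzDomain

/-! ### Contraction argument -/

/-- A contraction argument: a nonlinear perturbation of the Riesz isomorphism. -/
theorem existsUnique_of_lipschitz {H : Type*} [NormedAddCommGroup H] [InnerProductSpace ℝ H]
    [CompleteSpace H] {M q : ℝ} (hM : 0 ≤ M) (hq : q < 1) (ℓ : StrongDual ℝ H)
    (N : H → StrongDual ℝ H) (hmap : ∀ u, ‖u‖ ≤ M → ‖ℓ - N u‖ ≤ M)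
    (hlip : ∀ u w, ‖u‖ ≤ M → ‖w‖ ≤ M → ‖N u - N w‖ ≤ q * ‖u - w‖) :
    ∃ u : H, ‖u‖ ≤ M ∧ (∀ v, inner ℝ u v + N u v = ℓ v) ∧
      ∀ w : H, ‖w‖ ≤ M → (∀ v, inner ℝ w v + N w v = ℓ v) → w = u := by
  set J := InnerProductSpace.toDual ℝ H
  -- By the Riesz representation, the weak equation is the fixed point equation.
  have hJ : ∀ u, (∀ v, inner ℝ u v + N u v = ℓ v) ↔ J.symm (ℓ - N u) = u := by
    intro u
    rw [LinearIsometryEquiv.symm_apply_eq, ContinuousLinearMap.ext_iff]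
    refine forall_congr' fun v => ?_
    rw [sub_apply, InnerProductSpace.toDual_apply_apply]
    constructor <;> intro h <;> linarith
  set F : H → H := fun u => J.symm (ℓ - N u)
  have hF : ∀ u w, ‖u‖ ≤ M → ‖w‖ ≤ M → dist (F u) (F w) ≤ q * dist u w := by
    intro u w hu hw
    rw [J.symm.dist_map, dist_eq_norm, dist_eq_norm, sub_sub_sub_cancel_left, norm_sub_rev]
    exact hlip u w hu hw
  have hmaps : Set.MapsTo F (Metric.closedBall 0 M) (Metric.closedBall 0 M) := by
    intro u hu
    rw [mem_closedBall_zero_iff] at hu ⊢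
    rw [J.symm.norm_map]
    exact hmap u hu
  have hcontr : ContractingWith q.toNNReal (hmaps.restrict F _ _) := by
    refine ⟨by simpa using hq, LipschitzWith.of_dist_le_mul fun u w => ?_⟩
    refine (hF u w (mem_closedBall_zero_iff.1 u.2) (mem_closedBall_zero_iff.1 w.2)).trans ?_
    exact mul_le_mul_of_nonneg_right (Real.le_coe_toNNReal q) dist_nonneg
  obtain ⟨u, hu, hfix, -⟩ := hcontr.exists_fixedPoint' Metric.isClosed_closedBall.isComplete hmaps
    (Metric.mem_closedBall_self hM) (edist_ne_top _ _)
  rw [mem_closedBall_zero_iff] at hu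
  refine ⟨u, hu, (hJ u).2 hfix, fun w hw hsol => ?_⟩
  have h1 := hF w u hw hu
  rw [show F w = w from (hJ w).1 hsol, show F u = u from hfix] at h1
  refine dist_le_zero.1 ?_
  nlinarith [dist_nonneg (x := w) (y := u)]

/-! ### Hölder estimates for the boundary terms -/

section Holder

variable {X : Type*} [MeasurableSpace X] {μ : Measure X} {φ a b c : X → ℝ} {ε : ℝ}

theorem integrable_bdd_mul_and_abs_integral_le (hφ : AEStronglyMeasurable φ μ)
    (hφε : ∀ᵐ x ∂μ, |φ x| ≤ ε) {f : X → ℝ} (hf : Integrable f μ) :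
    Integrable (fun x => φ x * f x) μ ∧ |∫ x, φ x * f x ∂μ| ≤ ε * (eLpNorm f 1 μ).toReal := by
  have hInt : Integrable (fun x => φ x * f x) μ := hf.bdd_mul hφ hφε
  refine ⟨hInt, ?_⟩
  have h1 : (eLpNorm f 1 μ).toReal = ∫ x, |f x| ∂μ := by
    rw [eLpNorm_one_eq_lintegral_enorm, ← integral_norm_eq_lintegral_enorm hf.1]
    rfl
  calc |∫ x, φ x * f x ∂μ| ≤ ∫ x, |φ x * f x| ∂μ := abs_integral_le_integral_abs
    _ ≤ ∫ x, ε * |f x| ∂μ := by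
        refine integral_mono_ae hInt.abs (hf.abs.const_mul ε) ?_
        filter_upwards [hφε] with x hx
        rw [abs_mul]
        exact mul_le_mul_of_nonneg_right hx (abs_nonneg _)
    _ = ε * (eLpNorm f 1 μ).toReal := by rw [integral_const_mul, h1]

theorem eLpNorm_mul_le (ha : MemLp a 2 μ) (hb : MemLp b 2 μ) :
    eLpNorm (fun x => a x * b x) 1 μ ≤ eLpNorm a 2 μ * eLpNorm b 2 μ := by
  have : ENNReal.HolderTriple 2 2 1 := ⟨by rw [ENNReal.inv_two_add_inv_two, inv_one]⟩
  have h := eLpNorm_smul_le_mul_eLpNorm (p := 2) (q := 2) (r := 1) hb.1 ha.1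
  exact h

/-- Hölder's inequality is applied twice, through the intermediate exponent (1/3 + 1/3)⁻¹ = 3/2. -/
theorem eLpNorm_mul_mul_le (ha : MemLp a 3 μ) (hb : MemLp b 3 μ) (hc : MemLp c 3 μ) :
    eLpNorm (fun x => a x * b x * c x) 1 μ ≤ eLpNorm a 3 μ * eLpNorm b 3 μ * eLpNorm c 3 μ := by
  have h3 : (3 : ℝ≥0∞)⁻¹ + 3⁻¹ + 3⁻¹ = 1 := by
    rw [show (3 : ℝ≥0∞)⁻¹ + 3⁻¹ + 3⁻¹ = 3 * 3⁻¹ by ring]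
    exact ENNReal.mul_inv_cancel (by norm_num) (by norm_num)
  have h₁ : ENNReal.HolderTriple 3 3 ((3 : ℝ≥0∞)⁻¹ + 3⁻¹)⁻¹ := ⟨by rw [inv_inv]⟩
  have h₂ : ENNReal.HolderTriple ((3 : ℝ≥0∞)⁻¹ + 3⁻¹)⁻¹ 3 1 := ⟨by rw [inv_inv, h3, inv_one]⟩
  have e1 := eLpNorm_smul_le_mul_eLpNorm (p := 3) (q := 3) (r := ((3 : ℝ≥0∞)⁻¹ + 3⁻¹)⁻¹) hb.1 ha.1
  have e2 := eLpNorm_smul_le_mul_eLpNorm (p := ((3 : ℝ≥0∞)⁻¹ + 3⁻¹)⁻¹) (q := 3) (r := 1) hc.1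
    (ha.1.smul hb.1)
  exact e2.trans (mul_le_mul_left e1 _)

theorem integral_bilinear_le (hφ : AEStronglyMeasurable φ μ) (hε : 0 ≤ ε)
    (hφε : ∀ᵐ x ∂μ, |φ x| ≤ ε) {A B : ℝ} (hA : 0 ≤ A) (hB : 0 ≤ B) (ha : MemLp a 2 μ)
    (hb : MemLp b 2 μ) (haA : eLpNorm a 2 μ ≤ ENNReal.ofReal A)
    (hbB : eLpNorm b 2 μ ≤ ENNReal.ofReal B) :
    Integrable (fun x => φ x * (a x * b x)) μ ∧ |∫ x, φ x * (a x * b x) ∂μ| ≤ ε * (A * B) := by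
  have h := (eLpNorm_mul_le ha hb).trans (mul_le_mul' haA hbB)
  rw [← ENNReal.ofReal_mul hA] at h
  obtain ⟨h1, h2⟩ := integrable_bdd_mul_and_abs_integral_le hφ hφε
    (memLp_one_iff_integrable.1 ⟨ha.1.mul hb.1, h.trans_lt ENNReal.ofReal_lt_top⟩)
  refine ⟨h1, h2.trans (mul_le_mul_of_nonneg_left ?_ hε)⟩
  exact ENNReal.toReal_le_of_le_ofReal (mul_nonneg hA hB) h

theorem integral_trilinear_le (hφ : AEStronglyMeasurable φ μ) (hε : 0 ≤ ε)
    (hφε : ∀ᵐ x ∂μ, |φ x| ≤ ε) {A B C : ℝ} (hA : 0 ≤ A) (hB : 0 ≤ B) (hC : 0 ≤ C)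
    (ha : MemLp a 3 μ) (hb : MemLp b 3 μ) (hc : MemLp c 3 μ)
    (haA : eLpNorm a 3 μ ≤ ENNReal.ofReal A) (hbB : eLpNorm b 3 μ ≤ ENNReal.ofReal B)
    (hcC : eLpNorm c 3 μ ≤ ENNReal.ofReal C) :
    Integrable (fun x => φ x * (a x * b x * c x)) μ ∧
      |∫ x, φ x * (a x * b x * c x) ∂μ| ≤ ε * (A * B * C) := by
  have h := (eLpNorm_mul_mul_le ha hb hc).trans (mul_le_mul' (mul_le_mul' haA hbB) hcC)
  rw [← ENNReal.ofReal_mul hA, ← ENNReal.ofReal_mul (mul_nonneg hA hB)] at h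
  obtain ⟨h1, h2⟩ := integrable_bdd_mul_and_abs_integral_le hφ hφε
    (memLp_one_iff_integrable.1 ⟨(ha.1.mul hb.1).mul hc.1, h.trans_lt ENNReal.ofReal_lt_top⟩)
  refine ⟨h1, h2.trans (mul_le_mul_of_nonneg_left ?_ hε)⟩
  exact ENNReal.toReal_le_of_le_ofReal (mul_nonneg (mul_nonneg hA hB) hC) h

end Holder

/-! ### The Robin problem in an abstract Hilbert space -/

section Abstract

variable {H X : Type*} [NormedAddCommGroup H] [InnerProductSpace ℝ H] [MeasurableSpace X]
  {σ : Measure X}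

/-- Integration of the trace against a weight is a continuous linear functional. -/
theorem exists_dual_eq_integral (T : H →L[ℝ] Lp ℝ 2 σ) (Γ : Set X) {f : X → ℝ} {C : ℝ}
    (hC : 0 ≤ C) (hInt : ∀ v, Integrable (fun x => f x * T v x) (σ.restrict Γ))
    (hb : ∀ v, |∫ x in Γ, f x * T v x ∂σ| ≤ C * ‖v‖) :
    ∃ L : StrongDual ℝ H, (∀ v, L v = ∫ x in Γ, f x * T v x ∂σ) ∧ ‖L‖ ≤ C := by
  refine ⟨LinearMap.mkContinuous
    { toFun := fun v => ∫ x in Γ, f x * T v x ∂σ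
      map_add' := fun v w => ?_
      map_smul' := fun c v => ?_ } C hb, fun v => rfl, LinearMap.mkContinuous_norm_le _ hC _⟩
  · rw [← integral_add (hInt v) (hInt w)]
    refine integral_congr_ae (ae_restrict_of_ae ?_)
    filter_upwards [Lp.coeFn_add (T v) (T w)] with x hx
    rw [map_add, hx, Pi.add_apply, mul_add]
  · rw [RingHom.id_apply, smul_eq_mul, ← integral_const_mul]
    refine integral_congr_ae (ae_restrict_of_ae ?_)
    filter_upwards [Lp.coeFn_smul c (T v)] with x hx
    rw [map_smul, hx, Pi.smul_apply, smul_eq_mul]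
    ring

theorem existsUnique_robin [CompleteSpace H] (T : H →L[ℝ] Lp ℝ 2 σ) (ΓN ΓR : Set X)
    {b₁ b₂ bN M ε κ : ℝ} (hb₁ : 0 ≤ b₁) (hb₂ : 0 ≤ b₂) (hbN : 0 ≤ bN) (hM : 0 ≤ M) (hε : 0 ≤ ε)
    (hκ : |κ| ≤ 1 / 2)
    (h₁ : ∀ u, eLpNorm (T u) 2 (σ.restrict ΓR) ≤ ENNReal.ofReal (b₁ * ‖u‖))
    (h₂ : ∀ u, eLpNorm (T u) 3 (σ.restrict ΓR) ≤ ENNReal.ofReal (b₂ * ‖u‖))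
    (hN : ∀ u, eLpNorm (T u) 2 (σ.restrict ΓN) ≤ ENNReal.ofReal (bN * ‖u‖))
    {φ Φ g : X → ℝ} (hφ : AEStronglyMeasurable φ (σ.restrict ΓR))
    (hφε : ∀ᵐ x ∂σ.restrict ΓR, |φ x| ≤ ε)
    (hΦ : MemLp Φ 2 (σ.restrict ΓN)) (hg : MemLp g 2 (σ.restrict ΓR))
    (hdata : bN * (eLpNorm Φ 2 (σ.restrict ΓN)).toReal +
      b₁ * (eLpNorm g 2 (σ.restrict ΓR)).toReal ≤ M / 2)
    (hε₁ : ε * b₁ ^ 2 ≤ 1 / 4) (hε₂ : ε * b₂ ^ 3 * M ≤ 1 / 2) :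
    ∃ u : H, ‖u‖ ≤ M ∧
      (∀ v, inner ℝ u v + ∫ x in ΓR, φ x * (T u x + κ * T u x ^ 2) * T v x ∂σ =
        (∫ x in ΓN, Φ x * T v x ∂σ) + ∫ x in ΓR, g x * T v x ∂σ) ∧
      ∀ w : H, ‖w‖ ≤ M →
        (∀ v, inner ℝ w v + ∫ x in ΓR, φ x * (T w x + κ * T w x ^ 2) * T v x ∂σ =
          (∫ x in ΓN, Φ x * T v x ∂σ) + ∫ x in ΓR, g x * T v x ∂σ) → w = u := by
  have m₁ : ∀ u, MemLp (T u) 2 (σ.restrict ΓR) := fun u => (Lp.memLp (T u)).restrict ΓR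
  have mN : ∀ u, MemLp (T u) 2 (σ.restrict ΓN) := fun u => (Lp.memLp (T u)).restrict ΓN
  -- Membership in L³ comes from the finite bound `h₂`, not from an embedding theorem.
  have m₂ : ∀ u, MemLp (T u) 3 (σ.restrict ΓR) := fun u =>
    ⟨(m₁ u).1, (h₂ u).trans_lt ENNReal.ofReal_lt_top⟩
  have dat : ∀ (Γ : Set X) (b : ℝ), 0 ≤ b →
      (∀ u, eLpNorm (T u) 2 (σ.restrict Γ) ≤ ENNReal.ofReal (b * ‖u‖)) → ∀ f : X → ℝ,
      MemLp f 2 (σ.restrict Γ) → ∃ L : StrongDual ℝ H, (∀ v, L v = ∫ x in Γ, f x * T v x ∂σ) ∧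
        ‖L‖ ≤ b * (eLpNorm f 2 (σ.restrict Γ)).toReal := by
    intro Γ b hb hbT f hf
    have key := fun v => integral_bilinear_le (φ := fun _ => (1 : ℝ)) (ε := 1)
      aestronglyMeasurable_const zero_le_one (Eventually.of_forall fun _ => by simp)
      ENNReal.toReal_nonneg (mul_nonneg hb (norm_nonneg v)) hf ((Lp.memLp (T v)).restrict Γ)
      (ENNReal.ofReal_toReal hf.eLpNorm_ne_top).ge (hbT v)
    simp only [one_mul] at key
    refine exists_dual_eq_integral T Γ (mul_nonneg hb ENNReal.toReal_nonneg)
      (fun v => (key v).1) fun v => (key v).2.trans_eq ?_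
    ring
  obtain ⟨LN, hLN, hLN'⟩ := dat ΓN bN hbN hN Φ hΦ
  obtain ⟨LR, hLR, hLR'⟩ := dat ΓR b₁ hb₁ h₁ g hg
  have bil := fun u v => integral_bilinear_le hφ hε hφε (mul_nonneg hb₁ (norm_nonneg u))
    (mul_nonneg hb₁ (norm_nonneg v)) (m₁ u) (m₁ v) (h₁ u) (h₁ v)
  have tri := fun u v w => integral_trilinear_le hφ hε hφε (mul_nonneg hb₂ (norm_nonneg u))
    (mul_nonneg hb₂ (norm_nonneg v)) (mul_nonneg hb₂ (norm_nonneg w)) (m₂ u) (m₂ v) (m₂ w)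
    (h₂ u) (h₂ v) (h₂ w)
  have split : ∀ u v, (fun x => φ x * (T u x + κ * T u x ^ 2) * T v x) =
      fun x => φ x * (T u x * T v x) + κ * (φ x * (T u x * T u x * T v x)) := by
    intro u v; ext x; ring
  have hInt : ∀ u v, Integrable (fun x => φ x * (T u x + κ * T u x ^ 2) * T v x)
      (σ.restrict ΓR) := fun u v => by
    rw [split]
    exact (bil u v).1.add ((tri u u v).1.const_mul κ)
  have hNex : ∀ u, ∃ L : StrongDual ℝ H,
      (∀ v, L v = ∫ x in ΓR, φ x * (T u x + κ * T u x ^ 2) * T v x ∂σ) ∧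
        ‖L‖ ≤ ε * b₁ ^ 2 * ‖u‖ + 1 / 2 * (ε * b₂ ^ 3 * ‖u‖ ^ 2) := by
    intro u
    refine exists_dual_eq_integral T ΓR (by positivity) (hInt u) fun v => ?_
    rw [split, integral_add (bil u v).1 ((tri u u v).1.const_mul κ), integral_const_mul]
    calc _ ≤ _ := abs_add_le _ _
      _ ≤ ε * (b₁ * ‖u‖ * (b₁ * ‖v‖)) + 1 / 2 * (ε * (b₂ * ‖u‖ * (b₂ * ‖u‖) * (b₂ * ‖v‖))) := by
          rw [abs_mul κ]
          exact add_le_add (bil u v).2 (mul_le_mul hκ (tri u u v).2 (abs_nonneg _) (by norm_num))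
      _ = _ := by ring
  choose N hNv hNb using hNex
  have hlip : ∀ u w, ‖u‖ ≤ M → ‖w‖ ≤ M → ‖N u - N w‖ ≤ 3 / 4 * ‖u - w‖ := by
    intro u w hu hw
    refine ContinuousLinearMap.opNorm_le_bound _ (by positivity) fun v => ?_
    have hsum : ‖u + w‖ ≤ 2 * M := (norm_add_le u w).trans (by linarith)
    -- Factor u² - w² = (u+w)(u-w); the factor u+w, of norm at most 2M, yields the term ½·εb₂³·2M ≤
    -- 1/2.
    have e : N u v - N w v = (∫ x in ΓR, φ x * (T (u - w) x * T v x) ∂σ) +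
        κ * ∫ x in ΓR, φ x * (T (u + w) x * T (u - w) x * T v x) ∂σ := by
      rw [hNv, hNv, ← integral_sub (hInt u v) (hInt w v), ← integral_const_mul,
        ← integral_add (bil (u - w) v).1 ((tri (u + w) (u - w) v).1.const_mul κ)]
      refine integral_congr_ae (ae_restrict_of_ae ?_)
      filter_upwards [Lp.coeFn_sub (T u) (T w), Lp.coeFn_add (T u) (T w)] with x hx hx'
      rw [map_sub, map_add, hx, hx', Pi.sub_apply, Pi.add_apply]
      ring
    rw [sub_apply, e, Real.norm_eq_abs]
    have hd : 0 ≤ ‖u - w‖ * ‖v‖ := by positivity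
    calc _ ≤ _ := abs_add_le _ _
      _ ≤ ε * (b₁ * ‖u - w‖ * (b₁ * ‖v‖)) +
          1 / 2 * (ε * (b₂ * ‖u + w‖ * (b₂ * ‖u - w‖) * (b₂ * ‖v‖))) := by
          rw [abs_mul κ]
          exact add_le_add (bil (u - w) v).2
            (mul_le_mul hκ (tri (u + w) (u - w) v).2 (abs_nonneg _) (by norm_num))
      _ = ε * b₁ ^ 2 * (‖u - w‖ * ‖v‖) +
          1 / 2 * (ε * b₂ ^ 3 * ‖u + w‖) * (‖u - w‖ * ‖v‖) := by ring
      _ ≤ 1 / 4 * (‖u - w‖ * ‖v‖) + 1 / 2 * 1 * (‖u - w‖ * ‖v‖) := by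
          have : ε * b₂ ^ 3 * ‖u + w‖ ≤ 1 :=
            (mul_le_mul_of_nonneg_left hsum (by positivity)).trans (by linarith)
          gcongr
      _ = _ := by ring
  have hmap : ∀ u, ‖u‖ ≤ M → ‖(LN + LR) - N u‖ ≤ M := by
    intro u hu
    have e1 : ε * b₁ ^ 2 * ‖u‖ ≤ 1 / 4 * M :=
      mul_le_mul hε₁ hu (norm_nonneg _) (by norm_num)
    have e2 : ε * b₂ ^ 3 * ‖u‖ ^ 2 ≤ 1 / 2 * M := by
      calc ε * b₂ ^ 3 * ‖u‖ ^ 2 ≤ ε * b₂ ^ 3 * M ^ 2 := by gcongr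
        _ = ε * b₂ ^ 3 * M * M := by ring
        _ ≤ _ := mul_le_mul_of_nonneg_right hε₂ hM
    have := norm_sub_le (LN + LR) (N u)
    have := norm_add_le LN LR
    have := hNb u
    linarith
  obtain ⟨u, hu, hsol, huniq⟩ := existsUnique_of_lipschitz hM (by norm_num) (LN + LR) N hmap hlip
  simp only [hNv, add_apply, hLN, hLR] at hsol huniq
  exact ⟨u, hu, hsol, huniq⟩

end Abstract

/-! ### Best trace constants and the load -/

/-- Dividing by the norm of u shows that the infimum is itself admissible. If that norm is zero,
finiteness provides some admissible C, which forces the trace norm to vanish. -/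
theorem eLpNorm_trace_le {Ω ΓD Γ : Set Plane} {p : ℝ≥0∞} (h : traceConst Ω ΓD Γ p ≠ ⊤)
    (u : V Ω ΓD) :
    eLpNorm u.trace p ((surf Ω).restrict Γ) ≤ traceConst Ω ΓD Γ p * normV u := by
  by_cases h0 : normV u = 0
  · have hlt : traceConst Ω ΓD Γ p < ⊤ := h.lt_top
    simp only [traceConst, iInf_lt_iff] at hlt
    obtain ⟨C, hC, -⟩ := hlt
    simpa [h0] using hC.2 u
  · have hfin : normV u ≠ ⊤ := Lp.eLpNorm_ne_top _
    rw [← ENNReal.div_le_iff h0 hfin]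
    refine le_iInf₂ fun C hC => ?_
    rw [ENNReal.div_le_iff h0 hfin]
    exact hC.2 u

theorem traceConst_ne_top {Ω ΓD Γ : Set Plane} {C : ℝ≥0}
    (hC : ∀ u : V Ω ΓD, eLpNorm u.trace 2 (surf Ω) ≤ C * normV u) :
    traceConst Ω ΓD Γ 2 ≠ ⊤ := by
  have hle : traceConst Ω ΓD Γ 2 ≤ (C + 1 : ℝ≥0) := by
    -- Admissible constants must be positive, hence C+1.
    refine iInf₂_le (C + 1) ⟨by positivity, fun u => ?_⟩
    refine (eLpNorm_mono_measure _ Measure.restrict_le_self).trans ((hC u).trans ?_)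
    gcongr
    exact le_self_add
  exact (hle.trans_lt ENNReal.coe_lt_top).ne

/-- The pairing of the trace with a datum vanishes if the bound for it does. -/
theorem integral_trace_eq_zero {H X : Type*} [NormedAddCommGroup H] [InnerProductSpace ℝ H]
    [MeasurableSpace X] {σ : Measure X} (T : H →L[ℝ] Lp ℝ 2 σ) {Γ : Set X} {b : ℝ} {k : X → ℝ}
    (hb : 0 ≤ b) (hbT : ∀ h, eLpNorm (T h) 2 (σ.restrict Γ) ≤ ENNReal.ofReal (b * ‖h‖))
    (hk : MemLp k 2 (σ.restrict Γ)) (hbk : b * (eLpNorm k 2 (σ.restrict Γ)).toReal ≤ 0) (h : H) :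
    ∫ x in Γ, k x * T h x ∂σ = 0 := by
  have key := (integral_bilinear_le (φ := fun _ => (1 : ℝ)) (ε := 1)
    aestronglyMeasurable_const zero_le_one (Eventually.of_forall fun _ => by simp)
    ENNReal.toReal_nonneg (mul_nonneg hb (norm_nonneg h)) hk
    ((Lp.memLp (T h)).restrict Γ)
    (ENNReal.ofReal_toReal hk.eLpNorm_ne_top).ge (hbT h)).2
  simp only [one_mul] at key
  refine abs_nonpos_iff.1 (key.trans ?_)
  nlinarith [norm_nonneg h]

/-- The load is bounded by half of the radius `M₀`. -/
theorem traceConst_mul_data_le {Ω ΓD ΓN ΓR : Set Plane} {Φ g : Plane → ℝ}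
    (hβ₁ : traceConst Ω ΓD ΓR 2 ≠ ⊤) (hβN : traceConst Ω ΓD ΓN 2 ≠ ⊤)
    (hΦ : MemLp Φ 2 ((surf Ω).restrict ΓN)) (hg : MemLp g 2 ((surf Ω).restrict ΓR)) :
    (traceConst Ω ΓD ΓN 2).toReal * (eLpNorm Φ 2 ((surf Ω).restrict ΓN)).toReal +
      (traceConst Ω ΓD ΓR 2).toReal * (eLpNorm g 2 ((surf Ω).restrict ΓR)).toReal ≤
        (M₀ Ω ΓD ΓN ΓR Φ g).toReal / 2 := by
  rw [M₀, ENNReal.toReal_mul, ENNReal.toReal_mul, ENNReal.toReal_max hβ₁ hβN,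
    ENNReal.toReal_add hΦ.eLpNorm_ne_top hg.eLpNorm_ne_top, ENNReal.toReal_ofNat]
  have e1 := mul_le_mul_of_nonneg_right
    (le_max_right (traceConst Ω ΓD ΓR 2).toReal (traceConst Ω ΓD ΓN 2).toReal)
    (ENNReal.toReal_nonneg (a := eLpNorm Φ 2 ((surf Ω).restrict ΓN)))
  have e2 := mul_le_mul_of_nonneg_right
    (le_max_left (traceConst Ω ΓD ΓR 2).toReal (traceConst Ω ΓD ΓN 2).toReal)
    (ENNReal.toReal_nonneg (a := eLpNorm g 2 ((surf Ω).restrict ΓR)))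
  linarith

end RobinProblem

end

/-! ### The theorem -/

set_option maxHeartbeats 1000000 in
theorem theorem3p1 (Ω ΓD ΓN ΓR : Set Plane) (hΩ : IsLipschitzDomain Ω)
    (hΓ : IsBoundaryPartition Ω ΓD ΓN ΓR)
    (α : ℝ) (hα : α ∈ Set.Ioo (0 : ℝ) 1)
    (Φ g : Plane → ℝ) (hΦ : MemLp Φ 2 ((surf Ω).restrict ΓN))
    (hg : MemLp g 2 ((surf Ω).restrict ΓR))
    (ε : ℝ) (hε : 0 < ε)
    (hε' : ENNReal.ofReal ε < min (1 / (4 * traceConst Ω ΓD ΓR 2 ^ 2))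
      (1 / (2 * traceConst Ω ΓD ΓR 3 ^ 3 * M₀ Ω ΓD ΓN ΓR Φ g)))
    (φ : Plane → ℝ) (hφ : ContinuousOn φ (closure ΓR))
    (hφε : eLpNorm φ ∞ ((surf Ω).restrict ΓR) < ENNReal.ofReal ε) :
    ∃ u : V Ω ΓD, IsWeakSolution ΓN ΓR α φ Φ g u ∧ normV u ≤ M₀ Ω ΓD ΓN ΓR Φ g ∧
      ∀ w : V Ω ΓD, IsWeakSolution ΓN ΓR α φ Φ g w → normV w ≤ M₀ Ω ΓD ΓN ΓR Φ g → w = u := by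
  obtain ⟨H, T, f, hcl, hgrad, htr⟩ := hΩ.exists_equiv_submodule hΓ.posD
  have : CompleteSpace H := hcl.completeSpace_coe
  have hnorm : ∀ v, normV v = ENNReal.ofReal ‖f v‖ := fun v => by
    rw [Submodule.coe_norm, hgrad, Lp.norm_def, ENNReal.ofReal_toReal (Lp.eLpNorm_ne_top _)]
    rfl
  have hT : ∀ u : V Ω ΓD, eLpNorm u.trace 2 (surf Ω) ≤ ‖T‖₊ * normV u := by
    intro u
    have h := T.le_opNorm (f u)
    rw [htr, Lp.norm_def] at h
    rw [hnorm, ← ENNReal.ofReal_toReal (Lp.eLpNorm_ne_top u.trace),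
      show ((‖T‖₊ : ℝ≥0) : ℝ≥0∞) = ENNReal.ofReal ‖T‖ from (ofReal_norm T).symm]
    refine le_trans ?_ (ENNReal.ofReal_mul (norm_nonneg T)).le
    exact ENNReal.ofReal_le_ofReal h
  have hβ₁ : traceConst Ω ΓD ΓR 2 ≠ ⊤ := traceConst_ne_top hT
  have hβN : traceConst Ω ΓD ΓN 2 ≠ ⊤ := traceConst_ne_top hT
  have hM : M₀ Ω ΓD ΓN ΓR Φ g ≠ ⊤ := by
    have h1 := hΦ.eLpNorm_ne_top
    have h2 := hg.eLpNorm_ne_top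
    have h3 := (max_lt hβ₁.lt_top hβN.lt_top).ne
    unfold M₀
    finiteness
  set β₁ := traceConst Ω ΓD ΓR 2
  set β₂ := traceConst Ω ΓD ΓR 3
  set βN := traceConst Ω ΓD ΓN 2
  set M := (M₀ Ω ΓD ΓN ΓR Φ g).toReal with hMdef
  have hM' : M₀ Ω ΓD ΓN ΓR Φ g = ENNReal.ofReal M := (ENNReal.ofReal_toReal hM).symm
  have hM0 : 0 ≤ M := ENNReal.toReal_nonneg
  have bound : ∀ {Γ : Set Plane} {p : ℝ≥0∞}, traceConst Ω ΓD Γ p ≠ ⊤ → ∀ h : H,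
      eLpNorm (T h) p ((surf Ω).restrict Γ) ≤
        ENNReal.ofReal ((traceConst Ω ΓD Γ p).toReal * ‖h‖) := by
    intro Γ p hne h
    obtain ⟨v, rfl⟩ := f.surjective h
    rw [htr, ENNReal.ofReal_mul ENNReal.toReal_nonneg, ENNReal.ofReal_toReal hne, ← hnorm]
    exact eLpNorm_trace_le hne v
  have hdata : βN.toReal * (eLpNorm Φ 2 ((surf Ω).restrict ΓN)).toReal +
      β₁.toReal * (eLpNorm g 2 ((surf Ω).restrict ΓR)).toReal ≤ M / 2 :=
    traceConst_mul_data_le hβ₁ hβN hΦ hg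
  have hsol : ∀ u : V Ω ΓD, IsWeakSolution ΓN ΓR α φ Φ g u ↔
      ∀ h : H, inner ℝ (f u) h + ∫ x in ΓR, φ x * (T (f u) x + (2 * α - 1) / 2 * T (f u) x ^ 2) *
        T h x ∂(surf Ω) =
        (∫ x in ΓN, Φ x * T h x ∂(surf Ω)) + ∫ x in ΓR, g x * T h x ∂(surf Ω) := by
    intro u
    refine Iff.trans ?_ f.surjective.forall.symm
    refine forall_congr' fun v => ?_
    rw [htr, htr, Submodule.coe_inner, hgrad, hgrad, L2.inner_def]
  rcases hM0.eq_or_lt with hM0 | hMpos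
  -- Degenerate case M₀ = 0: the bound on ε reads its second term as 1/0 = ∞ and says nothing about
  -- β₂, but the ball is {0}, and `hdata` makes both load terms vanish, so 0 is a solution.
  · have hzero : ∀ w : V Ω ΓD, normV w ≤ M₀ Ω ΓD ΓN ΓR Φ g → f w = 0 := fun w hw => by
      rw [hM', ← hM0, hnorm, ENNReal.ofReal_zero, nonpos_iff_eq_zero, ENNReal.ofReal_eq_zero] at hw
      exact norm_le_zero_iff.1 hw
    have e1 : 0 ≤ βN.toReal * (eLpNorm Φ 2 ((surf Ω).restrict ΓN)).toReal := by positivity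
    have e2 : 0 ≤ β₁.toReal * (eLpNorm g 2 ((surf Ω).restrict ΓR)).toReal := by positivity
    refine ⟨f.symm 0, (hsol _).2 fun h => ?_, ?_, fun w _ hw => ?_⟩
    · rw [integral_trace_eq_zero T ENNReal.toReal_nonneg (bound hβN) hΦ (by linarith),
        integral_trace_eq_zero T ENNReal.toReal_nonneg (bound hβ₁) hg (by linarith),
        f.apply_symm_apply, map_zero,
        inner_zero_left, zero_add, add_zero]
      refine integral_eq_zero_of_ae (ae_restrict_of_ae ?_)
      filter_upwards [Lp.coeFn_zero ℝ 2 (surf Ω)] with x hx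
      rw [hx]
      simp
    · rw [hnorm, f.apply_symm_apply, norm_zero, ENNReal.ofReal_zero]
      exact zero_le
    · rw [f.eq_symm_apply]
      exact hzero w hw
  · have hε₁ : ENNReal.ofReal ε * (4 * β₁ ^ 2) ≤ 1 :=
      ENNReal.mul_le_of_le_div (hε'.le.trans (min_le_left _ _))
    have hε₂ : ENNReal.ofReal ε * (2 * β₂ ^ 3 * M₀ Ω ΓD ΓN ΓR Φ g) ≤ 1 :=
      ENNReal.mul_le_of_le_div (hε'.le.trans (min_le_right _ _))
    -- If β₂ were infinite, then M₀ > 0 would make the second bound on ε equal to 0, against ε > 0.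
    have hβ₂ : β₂ ≠ ⊤ := by
      intro htop
      rw [htop, ENNReal.top_pow (by norm_num), ENNReal.mul_top (by norm_num), ENNReal.top_mul,
        ENNReal.mul_top] at hε₂
      · simp at hε₂
      · simpa using hε
      · simpa [hM'] using hMpos
    have hε₁' : ε * β₁.toReal ^ 2 ≤ 1 / 4 := by
      have := ENNReal.toReal_mono ENNReal.one_ne_top hε₁
      simp only [ENNReal.toReal_mul, ENNReal.toReal_ofReal hε.le, ENNReal.toReal_pow,
        ENNReal.toReal_ofNat, ENNReal.toReal_one] at this
      linarith
    have hε₂' : ε * β₂.toReal ^ 3 * M ≤ 1 / 2 := by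
      have := ENNReal.toReal_mono ENNReal.one_ne_top hε₂
      simp only [ENNReal.toReal_mul, ENNReal.toReal_ofReal hε.le, ENNReal.toReal_pow,
        ENNReal.toReal_ofNat, ENNReal.toReal_one, ← hMdef] at this
      linarith
    have hκ : |(2 * α - 1) / 2| ≤ 1 / 2 := by
      rw [abs_le]
      constructor <;> linarith [hα.1, hα.2]
    have hRm : MeasurableSet ΓR := by
      obtain ⟨U, hU, rfl⟩ := hΓ.openR
      exact hU.measurableSet.inter isClosed_frontier.measurableSet
    have hφ' : ∀ᵐ x ∂(surf Ω).restrict ΓR, |φ x| ≤ ε := by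
      rw [eLpNorm_exponent_top] at hφε
      filter_upwards [ae_le_eLpNormEssSup (f := φ) (μ := (surf Ω).restrict ΓR)] with x hx
      have := hx.trans hφε.le
      rw [← ofReal_norm, ENNReal.ofReal_le_ofReal_iff hε.le] at this
      exact this
    obtain ⟨h, hh, hhsol, huniq⟩ := existsUnique_robin T ΓN ΓR ENNReal.toReal_nonneg
      ENNReal.toReal_nonneg ENNReal.toReal_nonneg hM0 hε.le hκ (bound hβ₁) (bound hβ₂)
      (bound hβN) ((hφ.mono subset_closure).aestronglyMeasurable hRm) hφ' hΦ hg hdata hε₁' hε₂'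
    refine ⟨f.symm h, (hsol _).2 ?_, ?_, fun w hw hwM => ?_⟩
    · simpa only [f.apply_symm_apply] using hhsol
    · rw [hnorm, f.apply_symm_apply, hM']
      exact ENNReal.ofReal_le_ofReal hh
    · rw [f.eq_symm_apply]
      refine huniq _ ?_ ((hsol w).1 hw)
      rwa [hnorm, hM', ENNReal.ofReal_le_ofReal_iff hM0] at hwM
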